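/- Let $n_1,n_2,m\in\mathbb N$, $n=\min\{n_1,n_2\}$. On $\mathbb R^{n_1\times n_2}$ let $\langle A,B\rangle=\sum_{i,j}A_{ij}B_{ij}$, let $\|\cdot\|_F$ be the Frobenius norm, let $\sigma_1(X)\ge\sigma_2(X)\ge\cdots\ge\sigma_n(X)\ge 0$ be the singular values of $X$, let $\|X_{i,:}\|_2$ be the Euclidean norm of its $i$-th row and let $\rho_j(X)$ be the $j$-th largest of the row norms (with multiplicity); put $\sigma_j(X)=0$ for $j>n$ and $\rho_j(X)=0$ for $j>n_1$. For $\tau>0$ let \[ f_\tau(t)=\begin{cases}\tfrac12\tau^2\log(e\,t^2/\tau^2),&|t|>\tau,\\ \tfrac12t^2,&|t|\le\tau,\end{cases} \qquad f_0:=0=\lim_{\tau\downarrow0}f_\tau , \] \[ \mathcal F_{\mathrm{lr},\varepsilon}(X)=\sum_{i=1}^{n}f_\varepsilon(\sigma_i(X)),\qquad \mathcal F_{\mathrm{sp},\delta}(X)=\sum_{i=1}^{n_1}f_\delta(\|X_{i,:}\|_2),\qquad \mathcal F_{\varepsilon,\delta}=\mathcal F_{\mathrm{lr},\varepsilon}+\mathcal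 F_{\mathrm{sp},\delta}. \] For $X\in\mathbb R^{n_1\times n_2}$ and $\varepsilon,\delta>0$ let $U\in\mathbb R^{n_1\times n_1}$ and $V\in\mathbb R^{n_2\times n_2}$ be orthogonal matrices whose leading columns are left and right singular vectors of $X$ belonging to the singular values $\sigma_i(X)>\varepsilon$ (in non-increasing order), the remaining columns being an arbitrary orthonormal completion. Define \[ W^{\mathrm{lr}}_{X,\varepsilon}(Z)=U\Sigma_{n_1}^{-1}U^{\top}Z\,V\Sigma_{n_2}^{-1}V^{\top},\qquad \Sigma_d=\operatorname{diag}\big(\max(\sigma_i(X)/\varepsilon,1)\big)_{i=1}^{d}, \] \[ W^{\mathrm{sp}}_{X,\delta}=\operatorname{diag}\Big(\max\big(\|X_{i,:}\|_2^2/\delta^2,1\big)^{-1}\Big)_{i=1}^{n_1},\qquad W_{X,\varepsilon,\delta}(Z)=W^{\mathrm{lr}}_{X,\varepsilon}(Z)+W^{\mathrm{sp}}_{X,\delta}Z, \] and the quadratic models \[ \mathcal Q_{\mathrm{lr},\varepsilon}(Z|X)=\mathcal F_{\mathrm{lr},\varepsilon}(X)+\langle\nabla\mathcal F_{\mathrm{lr},\varepsilon}(X),Z-X\rangle+\tfrac12\langle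 Z-X,W^{\mathrm{lr}}_{X,\varepsilon}(Z-X)\rangle, \] \[ \mathcal Q_{\mathrm{sp},\delta}(Z|X)=\mathcal F_{\mathrm{sp},\delta}(X)+\langle\nabla\mathcal F_{\mathrm{sp},\delta}(X),Z-X\rangle+\tfrac12\langle Z-X,W^{\mathrm{sp}}_{X,\delta}(Z-X)\rangle . \] Let $\mathcal A:\mathbb R^{n_1\times n_2}\to\mathbb R^m$ be any linear map, $y\in\mathbb R^m$, and $\tilde r,\tilde s\in\mathbb N_0$. Let $(X^{(k)})_{k\ge1}$, $(\varepsilon_k)_{k\ge1}$, $(\delta_k)_{k\ge1}$ be produced by the IRLS algorithm: $X^{(1)}$ minimizes $\|X\|_F^2$ subject to $\mathcal A(X)=y$; $\varepsilon_1=\sigma_{\tilde r+1}(X^{(1)})$, $\delta_1=\rho_{\tilde s+1}(X^{(1)})$; and for $k\ge1$, as long as $\varepsilon_k,\delta_k>0$ (so that the weight operator is defined; otherwise the algorithm stops at iteration $k$), \[ X^{(k+1)}\in\operatorname*{arg\,min}_{X:\,\mathcal A(X)=y}\langle X,W_{X^{(k)},\varepsilon_k,\delta_k}(X)\rangle,\quad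 \varepsilon_{k+1}=\min\big(\varepsilon_k,\sigma_{\tilde r+1}(X^{(k+1)})\big),\quad \delta_{k+1}=\min\big(\delta_k,\rho_{\tilde s+1}(X^{(k+1)})\big). \] Then the following hold. 1. For every iteration $k\ge1$ with $\varepsilon_k,\delta_k>0$, the functions $\mathcal F_{\mathrm{lr},\varepsilon_k}$ and $\mathcal F_{\mathrm{sp},\delta_k}$ are differentiable at $X^{(k)}$ (so that the quadratic models are well defined), and for all $Z\in\mathbb R^{n_1\times n_2}$ \[ \mathcal F_{\varepsilon_k,\delta_k}(Z)\le\mathcal Q_{\mathrm{lr},\varepsilon_k}(Z|X^{(k)})+\mathcal Q_{\mathrm{sp},\delta_k}(Z|X^{(k)}). \] 2. The sequence $\mathcal F_{\varepsilon_k,\delta_k}(X^{(k)})$ is non-increasing: $\mathcal F_{\varepsilon_{k+1},\delta_{k+1}}(X^{(k+1)})\le\mathcal F_{\varepsilon_k,\delta_k}(X^{(k)})$ for every $k\ge1$ for which iteration $k+1$ is performed, i.e. with $\varepsilon_k,\delta_k>0$. 3. If the algorithm does not stop and $\bar\varepsilon:=\lim_k\varepsilon_k>0$ and $\bar\delta:=\lim_k\delta_k>0$,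 then $\lim_{k\to\infty}\|X^{(k)}-X^{(k+1)}\|_F=0$, and every accumulation point $\bar X$ of $(X^{(k)})_{k\ge1}$ is a stationary point of $\min_{X:\,\mathcal A(X)=y}\mathcal F_{\bar\varepsilon,\bar\delta}(X)$, i.e. $\mathcal A(\bar X)=y$, $\mathcal F_{\bar\varepsilon,\bar\delta}$ is differentiable at $\bar X$, and $\langle\nabla\mathcal F_{\bar\varepsilon,\bar\delta}(\bar X),\Xi\rangle=0$ for all $\Xi\in\ker\mathcal A$. -/

import Mathlib

open Filter Topology
open scoped Matrix Matrix.Norms.Frobenius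

namespace IRLS

/-- Frobenius inner product `⟨A, B⟩ = ∑ᵢⱼ Aᵢⱼ Bᵢⱼ`. The norm on matrices is the Frobenius norm
throughout. -/
def frobInner {n₁ n₂ : ℕ} (A B : Matrix (Fin n₁) (Fin n₂) ℝ) : ℝ :=
  ∑ i, ∑ j, A i j * B i j

/-- Singular values in non-increasing order, indexed from `0` (so `sing X r` is the `(r+1)`-st
singular value), and `0` for indices `≥ min n₁ n₂`. -/
noncomputable def sing {n₁ n₂ : ℕ} (X : Matrix (Fin n₁) (Fin n₂) ℝ) (i : ℕ) : ℝ :=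
  (Matrix.toEuclideanLin X).singularValues i

/-- Euclidean norm of the `i`-th row. -/
noncomputable def rowNorm {n₁ n₂ : ℕ} (X : Matrix (Fin n₁) (Fin n₂) ℝ) (i : Fin n₁) : ℝ :=
  ‖WithLp.toLp 2 (X i)‖

/-- The `(s+1)`-st largest Euclidean row norm (with multiplicity); `0` if `s ≥ n₁`. -/
noncomputable def rowNormSorted {n₁ n₂ : ℕ} (X : Matrix (Fin n₁) (Fin n₂) ℝ) (s : ℕ) : ℝ :=
  (((Finset.univ : Finset (Fin n₁)).val.map (rowNorm X)).sort (· ≥ ·)).getD s 0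

/-- The scalar smoothed logarithm: quadratic for `|t| ≤ τ`, logarithmic for `|t| > τ`. For `τ = 0`
it is identically `0`, which is the pointwise limit as `τ → 0`. -/
noncomputable def fSmooth (τ t : ℝ) : ℝ :=
  if τ < |t| then (1 / 2) * τ ^ 2 * Real.log (Real.exp 1 * t ^ 2 / τ ^ 2) else (1 / 2) * t ^ 2

/-- Smoothed log-determinant objective. -/
noncomputable def Flr {n₁ n₂ : ℕ} (ε : ℝ) (X : Matrix (Fin n₁) (Fin n₂) ℝ) : ℝ :=
  ∑ i ∈ Finset.range (min n₁ n₂), fSmooth ε (sing X i)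

/-- Smoothed sum of logarithmic row norms. -/
noncomputable def Fsp {n₁ n₂ : ℕ} (δ : ℝ) (X : Matrix (Fin n₁) (Fin n₂) ℝ) : ℝ :=
  ∑ i, fSmooth δ (rowNorm X i)

/-- The smoothed logarithmic surrogate objective. -/
noncomputable def F {n₁ n₂ : ℕ} (ε δ : ℝ) (X : Matrix (Fin n₁) (Fin n₂) ℝ) : ℝ :=
  Flr ε X + Fsp δ X

/-- The gradient with respect to the Frobenius inner product: the matrix of partial derivatives. -/
noncomputable def matGrad {n₁ n₂ : ℕ} (G : Matrix (Fin n₁) (Fin n₂) ℝ → ℝ)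
    (X : Matrix (Fin n₁) (Fin n₂) ℝ) : Matrix (Fin n₁) (Fin n₂) ℝ :=
  Matrix.of fun i j => fderiv ℝ G X (Matrix.single i j 1)

/-- `U` and `V` are orthogonal matrices whose leading columns are left and right singular vectors
of `X` for the singular values exceeding `ε` (in non-increasing order); the remaining columns are
an arbitrary orthonormal completion. -/
structure IsSingularBases {n₁ n₂ : ℕ} (X : Matrix (Fin n₁) (Fin n₂) ℝ) (ε : ℝ)
    (U : Matrix (Fin n₁) (Fin n₁) ℝ) (V : Matrix (Fin n₂) (Fin n₂) ℝ) : Prop where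
  left_orthogonal : U ∈ Matrix.orthogonalGroup (Fin n₁) ℝ
  right_orthogonal : V ∈ Matrix.orthogonalGroup (Fin n₂) ℝ
  mul_right : ∀ (i : Fin n₁) (j : Fin n₂), (i : ℕ) = j → ε < sing X i →
    X *ᵥ V.col j = sing X i • U.col i
  mul_left : ∀ (i : Fin n₁) (j : Fin n₂), (i : ℕ) = j → ε < sing X i →
    Xᵀ *ᵥ U.col i = sing X i • V.col j

/-- The `n × n` diagonal matrix with entries `max(σᵢ(X)/ε, 1)⁻¹`; the entries beyond
`min n₁ n₂` are `1`. -/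
noncomputable def sigmaInv {n₁ n₂ : ℕ} (X : Matrix (Fin n₁) (Fin n₂) ℝ) (ε : ℝ) (n : ℕ) :
    Matrix (Fin n) (Fin n) ℝ :=
  Matrix.diagonal fun i => (max (sing X i / ε) 1)⁻¹

/-- Low-rank promoting part of the weight operator. -/
noncomputable def Wlr {n₁ n₂ : ℕ} (X : Matrix (Fin n₁) (Fin n₂) ℝ) (ε : ℝ)
    (U : Matrix (Fin n₁) (Fin n₁) ℝ) (V : Matrix (Fin n₂) (Fin n₂) ℝ)
    (Z : Matrix (Fin n₁) (Fin n₂) ℝ) : Matrix (Fin n₁) (Fin n₂) ℝ :=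
  U * sigmaInv X ε n₁ * Uᵀ * Z * V * sigmaInv X ε n₂ * Vᵀ

/-- Sparsity promoting part of the weight operator, a diagonal matrix. -/
noncomputable def Wsp {n₁ n₂ : ℕ} (X : Matrix (Fin n₁) (Fin n₂) ℝ) (δ : ℝ) :
    Matrix (Fin n₁) (Fin n₁) ℝ :=
  Matrix.diagonal fun i => (max (rowNorm X i ^ 2 / δ ^ 2) 1)⁻¹

/-- The weight operator. -/
noncomputable def W {n₁ n₂ : ℕ} (X : Matrix (Fin n₁) (Fin n₂) ℝ) (ε δ : ℝ)
    (U : Matrix (Fin n₁) (Fin n₁) ℝ) (V : Matrix (Fin n₂) (Fin n₂) ℝ)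
    (Z : Matrix (Fin n₁) (Fin n₂) ℝ) : Matrix (Fin n₁) (Fin n₂) ℝ :=
  Wlr X ε U V Z + Wsp X δ * Z

/-- The quadratic model of `Flr ε` at `X`, evaluated at `Z`. -/
noncomputable def Qlr {n₁ n₂ : ℕ} (X : Matrix (Fin n₁) (Fin n₂) ℝ) (ε : ℝ)
    (U : Matrix (Fin n₁) (Fin n₁) ℝ) (V : Matrix (Fin n₂) (Fin n₂) ℝ)
    (Z : Matrix (Fin n₁) (Fin n₂) ℝ) : ℝ :=
  Flr ε X + frobInner (matGrad (Flr ε) X) (Z - X)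
    + (1 / 2) * frobInner (Z - X) (Wlr X ε U V (Z - X))

/-- The quadratic model of `Fsp δ` at `X`, evaluated at `Z`. -/
noncomputable def Qsp {n₁ n₂ : ℕ} (X : Matrix (Fin n₁) (Fin n₂) ℝ) (δ : ℝ)
    (Z : Matrix (Fin n₁) (Fin n₂) ℝ) : ℝ :=
  Fsp δ X + frobInner (matGrad (Fsp δ) X) (Z - X)
    + (1 / 2) * frobInner (Z - X) (Wsp X δ * (Z - X))

/-- `X` solves the weighted least squares problem `min ⟨Z, T(Z)⟩` subject to `𝒜(Z) = y`. -/
def IsWLSSolution {n₁ n₂ m : ℕ} (A : Matrix (Fin n₁) (Fin n₂) ℝ →ₗ[ℝ] (Fin m → ℝ))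
    (y : Fin m → ℝ) (T : Matrix (Fin n₁) (Fin n₂) ℝ → Matrix (Fin n₁) (Fin n₂) ℝ)
    (X : Matrix (Fin n₁) (Fin n₂) ℝ) : Prop :=
  A X = y ∧ ∀ Z, A Z = y → frobInner X (T X) ≤ frobInner Z (T Z)

/-- Iterates `X k`, smoothing parameters `ε k`, `δ k` and singular bases `U k`, `V k` (`k ≥ 1`) of
the algorithm with rank and sparsity estimates `r` and `s`. The first iterate is computed with the
identity weight operator and `ε₀ = δ₀ = ∞`. Iteration `k + 1` is performed with the weight operator
of iteration `k`, which exists only if `ε k > 0` and `δ k > 0`; otherwise the algorithm has stopped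
at iteration `k`, and (as `ε` and `δ` are non-increasing and non-negative) one of the smoothing
parameters is zero from then on, while the later `X k` are irrelevant. -/
structure IsIRLSSequence {n₁ n₂ m : ℕ} (A : Matrix (Fin n₁) (Fin n₂) ℝ →ₗ[ℝ] (Fin m → ℝ))
    (y : Fin m → ℝ) (r s : ℕ) (X : ℕ → Matrix (Fin n₁) (Fin n₂) ℝ) (ε δ : ℕ → ℝ)
    (U : ℕ → Matrix (Fin n₁) (Fin n₁) ℝ) (V : ℕ → Matrix (Fin n₂) (Fin n₂) ℝ) : Prop where
  wls_one : IsWLSSolution A y (fun Z => Z) (X 1)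
  eps_one : ε 1 = sing (X 1) r
  delta_one : δ 1 = rowNormSorted (X 1) s
  bases : ∀ k, 1 ≤ k → 0 < ε k → 0 < δ k → IsSingularBases (X k) (ε k) (U k) (V k)
  wls_succ : ∀ k, 1 ≤ k → 0 < ε k → 0 < δ k →
    IsWLSSolution A y (W (X k) (ε k) (δ k) (U k) (V k)) (X (k + 1))
  eps_succ : ∀ k, 1 ≤ k → ε (k + 1) = min (ε k) (sing (X (k + 1)) r)
  delta_succ : ∀ k, 1 ≤ k → δ (k + 1) = min (δ k) (rowNormSorted (X (k + 1)) s)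

/-- `X` is a stationary point of `min G(Z)` subject to `𝒜(Z) = y`: it is feasible, `G` is
differentiable at `X`, and the gradient is orthogonal to the kernel of `𝒜`. -/
def IsStationaryPoint {n₁ n₂ m : ℕ} (A : Matrix (Fin n₁) (Fin n₂) ℝ →ₗ[ℝ] (Fin m → ℝ))
    (y : Fin m → ℝ) (G : Matrix (Fin n₁) (Fin n₂) ℝ → ℝ)
    (X : Matrix (Fin n₁) (Fin n₂) ℝ) : Prop :=
  A X = y ∧ DifferentiableAt ℝ G X ∧
    ∀ Ξ : Matrix (Fin n₁) (Fin n₂) ℝ, A Ξ = 0 → frobInner (matGrad G X) Ξ = 0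

end IRLS

/-!
At an iterate `X`, the objective `F ε δ` is majorized by a quadratic function whose Hessian is the
weight operator at `X` and which touches `F ε δ` at `X`. For the row norms this comes from the
variational formula `fSmooth τ t = min_{0 < μ ≤ 1} (μ t² / 2 - τ² log μ / 2)`. For the singular
values it becomes `Flr τ Z = min_K (‖K Z‖² / 2 - τ² log |det K|)` over contractions `K`, by
Hadamard's inequality; scaling by contractions on the left and on the right simultaneously gives
the two-sided weight. The next iterate minimizes the quadratic on the feasible set, so the objective
drops by at least half the weighted square norm of the step. Since the objective bounds the row
norms, the weight operator is bounded below and the steps tend to zero.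

The quadratic model is tangent because `F ε δ` also lies above a tangent concave parabola, by
von Neumann's trace inequality. In the limit, the majorization at `X k`, combined with the
optimality condition at `X (k + 1)`, bounds `F` along the kernel of `A` by a parabola
without linear term, which makes the directional derivatives vanish.
-/

namespace IRLS

open scoped InnerProductSpace

/-! ### Quadratic majorizers -/

section Majorizer

variable {E : Type*} [NormedAddCommGroup E] [InnerProductSpace ℝ E] {G : E → ℝ}
  {T : E →ₗ[ℝ] E} {x : E}

/-- `T` is the Hessian of a quadratic function without linear term that lies above `G` and touches
it at `x`. -/
def IsQuadraticMajorizer (G : E → ℝ) (T : E →ₗ[ℝ] E) (x : E) : Prop :=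
  ∀ z, G z ≤ G x + 1 / 2 * ⟪z, T z⟫_ℝ - 1 / 2 * ⟪x, T x⟫_ℝ

theorem inner_add_map_add (hT : T.IsSymmetric) (x d : E) :
    ⟪x + d, T (x + d)⟫_ℝ = ⟪x, T x⟫_ℝ + 2 * ⟪T x, d⟫_ℝ + ⟪d, T d⟫_ℝ := by
  have h : ⟪x, T d⟫_ℝ = ⟪T x, d⟫_ℝ := (hT x d).symm
  rw [map_add, inner_add_left, inner_add_right, inner_add_right, h, real_inner_comm d (T x)]
  ring

theorem inner_map_le_of_norm_le {C : ℝ} (hC : ∀ x, ‖T x‖ ≤ C * ‖x‖) (x y : E) :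
    ⟪T x, y⟫_ℝ ≤ C * ‖x‖ * ‖y‖ :=
  (real_inner_le_norm _ _).trans (mul_le_mul_of_nonneg_right (hC x) (norm_nonneg y))

theorem inner_map_eq_zero_of_forall_le (hT : T.IsSymmetric) {M : Type*} [AddCommGroup M]
    [Module ℝ M] {A : E →ₗ[ℝ] M} (h : ∀ z, A z = A x → ⟪x, T x⟫_ℝ ≤ ⟪z, T z⟫_ℝ) {d : E}
    (hd : A d = 0) : ⟪T x, d⟫_ℝ = 0 := by
  have hdisc : discrim ⟪d, T d⟫_ℝ (2 * ⟪T x, d⟫_ℝ) 0 ≤ 0 := discrim_le_zero fun t => by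
    have ht := h (x + t • d) (by rw [map_add, map_smul, hd, smul_zero, add_zero])
    rw [inner_add_map_add hT, map_smul, inner_smul_right, inner_smul_left, inner_smul_right] at ht
    simp only [conj_trivial] at ht
    linarith
  rw [discrim] at hdisc
  nlinarith

theorem hasFDerivAt_of_abs_sub_le {f' : E →L[ℝ] ℝ} {C : ℝ}
    (h : ∀ z, |G z - G x - f' (z - x)| ≤ C * ‖z - x‖ ^ 2) : HasFDerivAt G f' x := by
  refine .of_isLittleO (Asymptotics.IsBigO.trans_isLittleO ?_
    (Asymptotics.isLittleO_pow_sub_sub x one_lt_two))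
  refine .of_bound C (Eventually.of_forall fun z => ?_)
  simpa using h z

theorem fderiv_apply_eq_of_forall_le (hG : DifferentiableAt ℝ G x) {d : E} {b c : ℝ}
    (h : ∀ t : ℝ, G (x + t • d) ≤ G x + t * b + t ^ 2 * c) : fderiv ℝ G x d = b := by
  have hline : HasDerivAt (fun t : ℝ => G (x + t • d)) (fderiv ℝ G x d) 0 :=
    hG.hasFDerivAt.hasLineDerivAt d
  have hparabola : HasDerivAt (fun t : ℝ => t * b + t ^ 2 * c) b 0 := by
    simpa using ((hasDerivAt_id' (0 : ℝ)).mul_const b).fun_add ((hasDerivAt_pow 2 0).mul_const c)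
  have hmax : IsLocalMax (fun t : ℝ => G (x + t • d) - (t * b + t ^ 2 * c)) 0 :=
    Eventually.of_forall fun t => by
      have := h t
      simp only [zero_smul, add_zero]
      linarith
  exact sub_eq_zero.1 (hmax.hasDerivAt_eq_zero (hline.sub hparabola))

namespace IsQuadraticMajorizer

theorem add {G' : E → ℝ} {T' : E →ₗ[ℝ] E} (hG : IsQuadraticMajorizer G T x)
    (hG' : IsQuadraticMajorizer G' T' x) :
    IsQuadraticMajorizer (fun z => G z + G' z) (T + T') x := fun z => by
  have h := hG z
  have h' := hG' z
  simp only [LinearMap.add_apply, inner_add_right]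
  linarith

theorem apply_add_le (hG : IsQuadraticMajorizer G T x) (hT : T.IsSymmetric) (d : E) :
    G (x + d) ≤ G x + ⟪T x, d⟫_ℝ + 1 / 2 * ⟪d, T d⟫_ℝ := by
  have h := hG (x + d)
  rw [inner_add_map_add hT] at h
  linarith

theorem apply_le (hG : IsQuadraticMajorizer G T x) (hT : T.IsSymmetric) (z : E) :
    G z ≤ G x + ⟪T x, z - x⟫_ℝ + 1 / 2 * ⟪z - x, T (z - x)⟫_ℝ := by
  simpa using hG.apply_add_le hT (z - x)

theorem fderiv_apply (hG : IsQuadraticMajorizer G T x) (hT : T.IsSymmetric)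
    (hd : DifferentiableAt ℝ G x) (d : E) : fderiv ℝ G x d = ⟪T x, d⟫_ℝ :=
  fderiv_apply_eq_of_forall_le (c := 1 / 2 * ⟪d, T d⟫_ℝ) hd fun t => by
    have h := hG.apply_add_le hT (t • d)
    rw [map_smul, inner_smul_right, inner_smul_left, inner_smul_right] at h
    simp only [conj_trivial] at h
    linarith

theorem differentiableAt (hG : IsQuadraticMajorizer G T x) (hT : T.IsSymmetric) {C c : ℝ}
    (hC : ∀ x, ‖T x‖ ≤ C * ‖x‖) (h : ∀ z, G x + ⟪T x, z - x⟫_ℝ - c * ‖z - x‖ ^ 2 ≤ G z) :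
    DifferentiableAt ℝ G x := by
  refine (hasFDerivAt_of_abs_sub_le (f' := innerSL ℝ (T x)) (C := max c (C / 2))
    fun z => ?_).differentiableAt
  have hupper := hG.apply_le hT z
  have hquad : ⟪z - x, T (z - x)⟫_ℝ ≤ C * ‖z - x‖ * ‖z - x‖ := by
    rw [real_inner_comm]
    exact inner_map_le_of_norm_le hC _ _
  have hc := mul_le_mul_of_nonneg_right (le_max_left c (C / 2)) (sq_nonneg ‖z - x‖)
  have hC' := mul_le_mul_of_nonneg_right (le_max_right c (C / 2)) (sq_nonneg ‖z - x‖)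
  rw [innerSL_apply_apply, abs_le]
  constructor <;> linarith [h z]

theorem apply_add_half_inner_le (hG : IsQuadraticMajorizer G T x) (hT : T.IsSymmetric) {x' : E}
    (h : ⟪T x', x - x'⟫_ℝ = 0) : G x' + 1 / 2 * ⟪x - x', T (x - x')⟫_ℝ ≤ G x := by
  have hexp := inner_add_map_add hT x' (x - x')
  rw [h, add_sub_cancel] at hexp
  linarith [hG x']

theorem apply_add_le_of_inner_eq_zero (hG : IsQuadraticMajorizer G T x) (hT : T.IsSymmetric)
    {C : ℝ} (hC : ∀ x, ‖T x‖ ≤ C * ‖x‖) {x' d : E} (h : ⟪T x', d⟫_ℝ = 0) :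
    G (x + d) ≤ G x + C * ‖x - x'‖ * ‖d‖ + C / 2 * ‖d‖ ^ 2 := by
  have hlin : ⟪T x, d⟫_ℝ ≤ C * ‖x - x'‖ * ‖d‖ := by
    simpa [inner_sub_left, h] using inner_map_le_of_norm_le hC (x - x') d
  have hquad := inner_map_le_of_norm_le hC d d
  rw [real_inner_comm] at hquad
  linarith [hG.apply_add_le hT d]

theorem apply_sub_apply_le (hG : IsQuadraticMajorizer G T x) (hT : T.IsSymmetric) {C : ℝ}
    (hC : ∀ x, ‖T x‖ ≤ C * ‖x‖) (z : E) : G z - G x ≤ C / 2 * (‖x‖ + ‖z‖) * ‖z - x‖ := by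
  have hdiff : ⟪T (z - x), x + z⟫_ℝ = ⟪z, T z⟫_ℝ - ⟪x, T x⟫_ℝ := by
    have h : ⟪T x, z⟫_ℝ = ⟪T z, x⟫_ℝ := (hT x z).trans (real_inner_comm _ _)
    rw [map_sub, inner_sub_left, inner_add_right, inner_add_right, h, real_inner_comm z,
      real_inner_comm x (T x)]
    ring
  have hC0 : 0 ≤ C * ‖z - x‖ := (norm_nonneg _).trans (hC (z - x))
  have hle := (inner_map_le_of_norm_le hC (z - x) (x + z)).trans
    (mul_le_mul_of_nonneg_left (norm_add_le x z) hC0)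
  linarith [hG z]

end IsQuadraticMajorizer

theorem tendsto_apply_of_exists_isQuadraticMajorizer {ι : Type*} {l : Filter ι} {g : ι → E → ℝ}
    {C a : ℝ} {u : ι → E} (hu : Tendsto u l (𝓝 x)) (hx : Tendsto (fun k => g k x) l (𝓝 a))
    (h : ∀ᶠ k in l, ∀ z, ∃ T : E →ₗ[ℝ] E,
      T.IsSymmetric ∧ (∀ x, ‖T x‖ ≤ C * ‖x‖) ∧ IsQuadraticMajorizer (g k) T z) :
    Tendsto (fun k => g k (u k)) l (𝓝 a) := by
  have hdist : Tendsto (fun k => ‖u k - x‖) l (𝓝 0) := tendsto_iff_norm_sub_tendsto_zero.1 hu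
  have hbound : Tendsto (fun k => C / 2 * (‖x‖ + ‖u k‖) * ‖u k - x‖) l (𝓝 0) := by
    simpa using ((hu.norm.const_add ‖x‖).const_mul (C / 2)).mul hdist
  have hdiff : Tendsto (fun k => g k (u k) - g k x) l (𝓝 0) := by
    refine squeeze_zero_norm' (h.mono fun k hk => ?_) hbound
    obtain ⟨T, hT, hTC, hG⟩ := hk x
    obtain ⟨T', hT', hTC', hG'⟩ := hk (u k)
    have hle := hG.apply_sub_apply_le hT hTC (u k)
    have hge := hG'.apply_sub_apply_le hT' hTC' x
    rw [norm_sub_rev, add_comm] at hge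
    rw [Real.norm_eq_abs, abs_le]
    constructor <;> linarith
  simpa using hdiff.add hx

end Majorizer

/-! ### The scalar function `fSmooth` -/

/-- The square root `(max (t / τ) 1)⁻¹` of the reweighting factor `fSmooth' τ t / t`. It is also the
minimiser of `h ↦ h ^ 2 * t ^ 2 / 2 - τ ^ 2 * log h` over `(0, 1]`. -/
noncomputable def sqrtWeight (τ t : ℝ) : ℝ := (max (t / τ) 1)⁻¹

section Scalar

variable {τ t : ℝ}

theorem sqrtWeight_pos (τ t : ℝ) : 0 < sqrtWeight τ t :=
  inv_pos.2 (lt_of_lt_of_le one_pos (le_max_right _ _))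

theorem sqrtWeight_le_one (τ t : ℝ) : sqrtWeight τ t ≤ 1 :=
  inv_le_one_of_one_le₀ (le_max_right _ _)

theorem sqrtWeight_of_le (hτ : 0 < τ) (h : t ≤ τ) : sqrtWeight τ t = 1 := by
  rw [sqrtWeight, max_eq_right ((div_le_one hτ).2 h), inv_one]

theorem sqrtWeight_of_ge (hτ : 0 < τ) (h : τ ≤ t) : sqrtWeight τ t = τ / t := by
  rw [sqrtWeight, max_eq_left ((one_le_div hτ).2 h), inv_div]

theorem inv_max_sq_div_sq (hτ : 0 < τ) (ht : 0 ≤ t) :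
    (max (t ^ 2 / τ ^ 2) 1)⁻¹ = sqrtWeight τ t ^ 2 := by
  rw [sqrtWeight, inv_pow, pow_left_monotoneOn.map_max (div_nonneg ht hτ.le) (zero_le_one' ℝ),
    div_pow, one_pow]

theorem fSmooth_of_le (ht : 0 ≤ t) (h : t ≤ τ) : fSmooth τ t = 1 / 2 * t ^ 2 := by
  rw [fSmooth, if_neg (by rw [abs_of_nonneg ht]; exact h.not_gt)]

theorem fSmooth_of_ge (hτ : 0 < τ) (h : τ ≤ t) :
    fSmooth τ t = 1 / 2 * τ ^ 2 + τ ^ 2 * Real.log (t / τ) := by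
  have ht : 0 < t := hτ.trans_le h
  rcases h.eq_or_lt with rfl | h
  · rw [fSmooth_of_le hτ.le le_rfl, div_self hτ.ne', Real.log_one, mul_zero, add_zero]
  · rw [fSmooth, if_pos (by rwa [abs_of_pos ht]), mul_div_assoc, ← div_pow,
      Real.log_mul (Real.exp_ne_zero _) (by positivity), Real.log_exp, Real.log_pow]
    push_cast
    ring

@[simp]
theorem fSmooth_apply_zero (τ : ℝ) : fSmooth τ 0 = 0 := by
  simp [fSmooth]

theorem fSmooth_zero_left (t : ℝ) : fSmooth 0 t = 0 := by
  by_cases h : t = 0 <;> simp [fSmooth, h]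

theorem fSmooth_eq_sqrtWeight (hτ : 0 < τ) (ht : 0 ≤ t) :
    fSmooth τ t
      = 1 / 2 * sqrtWeight τ t ^ 2 * t ^ 2 - τ ^ 2 * Real.log (sqrtWeight τ t) := by
  rcases le_total t τ with h | h
  · rw [sqrtWeight_of_le hτ h, fSmooth_of_le ht h]
    simp
  · have ht' : 0 < t := hτ.trans_le h
    rw [sqrtWeight_of_ge hτ h, fSmooth_of_ge hτ h, ← inv_div t τ, Real.log_inv]
    field_simp
    ring

theorem fSmooth_le {μ : ℝ} (hτ : 0 < τ) (ht : 0 ≤ t) (hμ : 0 < μ) (hμ1 : μ ≤ 1) :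
    fSmooth τ t ≤ 1 / 2 * μ * t ^ 2 - 1 / 2 * τ ^ 2 * Real.log μ := by
  rcases le_total t τ with h | h
  · rw [fSmooth_of_le ht h]
    have hlog := mul_le_mul_of_nonneg_left (Real.log_le_sub_one_of_pos hμ) (sq_nonneg τ)
    have hsq : t ^ 2 ≤ τ ^ 2 := by gcongr
    linarith [mul_nonneg (sub_nonneg.2 hsq) (sub_nonneg.2 hμ1)]
  · rw [fSmooth_of_ge hτ h]
    have ht' : 0 < t := hτ.trans_le h
    have hlog := Real.log_le_sub_one_of_pos (show 0 < μ * (t / τ) ^ 2 by positivity)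
    rw [Real.log_mul hμ.ne' (by positivity), Real.log_pow, Nat.cast_two] at hlog
    have hscale : τ ^ 2 * (μ * (t / τ) ^ 2 - 1) = μ * t ^ 2 - τ ^ 2 := by field_simp
    linarith [mul_le_mul_of_nonneg_left hlog (sq_nonneg τ)]

theorem fSmooth_nonneg (hτ : 0 ≤ τ) (ht : 0 ≤ t) : 0 ≤ fSmooth τ t := by
  rcases hτ.eq_or_lt with rfl | hτ
  · rw [fSmooth_zero_left]
  · have hlog := Real.log_nonpos (sqrtWeight_pos τ t).le (sqrtWeight_le_one τ t)
    rw [fSmooth_eq_sqrtWeight hτ ht]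
    exact sub_nonneg.2 ((mul_nonpos_of_nonneg_of_nonpos (sq_nonneg τ) hlog).trans (by positivity))

theorem fSmooth_mono_left {τ' : ℝ} (hτ : 0 ≤ τ) (h : τ ≤ τ') (ht : 0 ≤ t) :
    fSmooth τ t ≤ fSmooth τ' t := by
  rcases hτ.eq_or_lt with rfl | hτ
  · rw [fSmooth_zero_left]
    exact fSmooth_nonneg h ht
  · have hw := sqrtWeight_pos τ' t
    have hw1 := sqrtWeight_le_one τ' t
    have hle := fSmooth_le hτ ht (pow_pos hw 2) (pow_le_one₀ hw.le hw1)
    have hsq : τ ^ 2 ≤ τ' ^ 2 := by gcongr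
    rw [Real.log_pow, Nat.cast_two] at hle
    rw [fSmooth_eq_sqrtWeight (hτ.trans_le h) ht]
    linarith [mul_le_mul_of_nonpos_right hsq (Real.log_nonpos hw.le hw1)]

theorem le_fSmooth_of_ge {σ : ℝ} (hτ : 0 < τ) (hσ : τ ≤ σ) (ht : τ ≤ t) :
    fSmooth τ σ + τ ^ 2 / σ * (t - σ) - (t - σ) ^ 2 ≤ fSmooth τ t := by
  have hσ' : 0 < σ := hτ.trans_le hσ
  have ht' : 0 < t := hτ.trans_le ht
  have hlog := mul_le_mul_of_nonneg_left (Real.one_sub_inv_le_log_of_pos (div_pos ht' hσ'))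
    (sq_nonneg τ)
  have hgap : τ ^ 2 * (1 - (t / σ)⁻¹) - (τ ^ 2 / σ * (t - σ) - (t - σ) ^ 2)
      = (t - σ) ^ 2 * (t * σ - τ * τ) / (t * σ) := by
    field_simp
    ring
  have hgap_nonneg : 0 ≤ (t - σ) ^ 2 * (t * σ - τ * τ) / (t * σ) := by
    have := sub_nonneg.2 (mul_le_mul ht hσ hτ.le ht'.le)
    positivity
  rw [Real.log_div ht'.ne' hσ'.ne'] at hlog
  rw [fSmooth_of_ge hτ hσ, fSmooth_of_ge hτ ht, Real.log_div ht'.ne' hτ.ne',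
    Real.log_div hσ'.ne' hτ.ne']
  linarith

/-- `fSmooth τ` is `C¹` with derivative `σ ↦ sqrtWeight τ σ ^ 2 * σ` and with second derivative at
least `-1` off the kink, so that both regimes can be compared through the value at `τ`. -/
theorem le_fSmooth {σ : ℝ} (hτ : 0 < τ) (hσ : 0 ≤ σ) (ht : 0 ≤ t) :
    fSmooth τ σ + sqrtWeight τ σ ^ 2 * σ * (t - σ) - (t - σ) ^ 2 ≤ fSmooth τ t := by
  have hslope (h : τ ≤ σ) : sqrtWeight τ σ ^ 2 * σ = τ ^ 2 / σ := by
    have hσ' : σ ≠ 0 := (hτ.trans_le h).ne'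
    rw [sqrtWeight_of_ge hτ h]
    field_simp
  rcases le_total σ τ with h | h <;> rcases le_total t τ with h' | h'
  · rw [fSmooth_of_le hσ h, fSmooth_of_le ht h', sqrtWeight_of_le hτ h]
    nlinarith [sq_nonneg (t - σ)]
  · have hτt := le_fSmooth_of_ge hτ le_rfl h'
    rw [fSmooth_of_le hτ.le le_rfl, sq τ, mul_self_div_self] at hτt
    rw [fSmooth_of_le hσ h, sqrtWeight_of_le hτ h]
    nlinarith [mul_nonneg (sub_nonneg.2 h) (sub_nonneg.2 h'), sq_nonneg (τ - σ)]
  · have hτσ := le_fSmooth_of_ge hτ h le_rfl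
    have hle : 2 * τ - σ ≤ τ ^ 2 / σ := by
      rw [le_div_iff₀ (hτ.trans_le h)]
      nlinarith [sq_nonneg (τ - σ)]
    rw [fSmooth_of_le hτ.le le_rfl] at hτσ
    rw [hslope h, fSmooth_of_le ht h']
    nlinarith [mul_nonneg (sub_nonneg.2 h') (sub_nonneg.2 hle),
      mul_nonneg (sub_nonneg.2 h') (sub_nonneg.2 h), sq_nonneg (τ - t)]
  · rw [hslope h]
    exact le_fSmooth_of_ge hτ h h'

theorem max_sq_div_sq_le_exp (hτ : 0 < τ) (ht : 0 ≤ t) :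
    max (t ^ 2 / τ ^ 2) 1 ≤ Real.exp (2 * fSmooth τ t / τ ^ 2) := by
  have hone : 1 ≤ Real.exp (2 * fSmooth τ t / τ ^ 2) :=
    Real.one_le_exp (by have := fSmooth_nonneg hτ.le ht; positivity)
  refine max_le ?_ hone
  rcases le_total t τ with h | h
  · exact (div_le_one_of_le₀ (by gcongr) (sq_nonneg τ)).trans hone
  · have ht' : 0 < t := hτ.trans_le h
    rw [← Real.log_le_iff_le_exp (by positivity), fSmooth_of_ge hτ h, ← div_pow, Real.log_pow,
      Nat.cast_two, le_div_iff₀ (by positivity)]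
    linarith [sq_nonneg τ]

theorem tendsto_fSmooth {ι : Type*} {l : Filter ι} {u : ι → ℝ} (hτ : 0 < τ) (ht : 0 ≤ t)
    (hu : Tendsto u l (𝓝 τ)) : Tendsto (fun k => fSmooth (u k) t) l (𝓝 (fSmooth τ t)) := by
  have hw : Tendsto (fun k => sqrtWeight (u k) t) l (𝓝 (sqrtWeight τ t)) :=
    ((tendsto_const_nhds.div hu hτ.ne').max tendsto_const_nhds).inv₀
      (lt_of_lt_of_le one_pos (le_max_right _ _)).ne'
  rw [fSmooth_eq_sqrtWeight hτ ht]
  refine Tendsto.congr' ((hu.eventually (eventually_gt_nhds hτ)).mono fun k hk =>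
    (fSmooth_eq_sqrtWeight hk ht).symm) ?_
  exact (((hw.pow 2).const_mul _).mul_const _).sub
    ((hu.pow 2).mul (hw.log (sqrtWeight_pos τ t).ne'))

end Scalar

/-! ### The Frobenius inner product -/

section FrobeniusInner

variable {l m n : Type*} [Fintype l] [Fintype m] [Fintype n]

/-- The inner product space structure whose norm is the Frobenius norm; on `Fin n₁ × Fin n₂`
matrices its inner product is `frobInner` by definition. -/
noncomputable local instance frobeniusInnerProductSpace : InnerProductSpace ℝ (Matrix m n ℝ) where
  toNormedSpace := Matrix.frobeniusNormedSpace
  inner A B := ∑ i, ∑ j, A i j * B i j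
  norm_sq_eq_re_inner A := by
    rw [Matrix.frobenius_norm_def, ← Real.sqrt_eq_rpow, Real.sq_sqrt (by positivity)]
    simp [sq]
  conj_inner_symm A B := by simp only [mul_comm, map_sum, conj_trivial]
  add_left A B C := by simp only [Matrix.add_apply, add_mul, Finset.sum_add_distrib]
  smul_left A B c := by
    simp only [Matrix.smul_apply, smul_eq_mul, Finset.mul_sum, conj_trivial, mul_assoc]

theorem inner_eq_sum (A B : Matrix m n ℝ) : ⟪A, B⟫_ℝ = ∑ i, ∑ j, A i j * B i j := rfl

theorem inner_eq_trace (A B : Matrix m n ℝ) : ⟪A, B⟫_ℝ = (Aᵀ * B).trace := Finset.sum_comm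

theorem norm_sq_eq_sum (A : Matrix m n ℝ) : ‖A‖ ^ 2 = ∑ i, ∑ j, A i j ^ 2 := by
  rw [← real_inner_self_eq_norm_sq, inner_eq_sum]
  simp only [sq]

theorem inner_transpose (A B : Matrix m n ℝ) : ⟪Aᵀ, Bᵀ⟫_ℝ = ⟪A, B⟫_ℝ := Finset.sum_comm

theorem inner_mul_left_eq (P : Matrix m l ℝ) (A : Matrix l n ℝ) (B : Matrix m n ℝ) :
    ⟪P * A, B⟫_ℝ = ⟪A, Pᵀ * B⟫_ℝ := by
  rw [inner_eq_trace, inner_eq_trace, Matrix.transpose_mul, Matrix.mul_assoc]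

theorem inner_mul_right_eq (A : Matrix m l ℝ) (P : Matrix l n ℝ) (B : Matrix m n ℝ) :
    ⟪A * P, B⟫_ℝ = ⟪A, B * Pᵀ⟫_ℝ := by
  rw [← inner_transpose, Matrix.transpose_mul, inner_mul_left_eq, ← inner_transpose A,
    Matrix.transpose_mul]

section Orthogonal

variable [DecidableEq m] [DecidableEq n] {P : Matrix m m ℝ} {Q : Matrix n n ℝ}

theorem transpose_mem_orthogonalGroup (hP : P ∈ Matrix.orthogonalGroup m ℝ) :
    Pᵀ ∈ Matrix.orthogonalGroup m ℝ :=
  Unitary.star_mem hP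

theorem transpose_mul_self_of_mem_orthogonalGroup (hP : P ∈ Matrix.orthogonalGroup m ℝ) :
    Pᵀ * P = 1 :=
  (Matrix.mem_orthogonalGroup_iff' m ℝ).1 hP

theorem abs_det_of_mem_orthogonalGroup (hP : P ∈ Matrix.orthogonalGroup m ℝ) : |P.det| = 1 :=
  CStarRing.norm_of_mem_unitary (Matrix.det_of_mem_unitary hP)

theorem sum_sq_row_of_mem_orthogonalGroup (hP : P ∈ Matrix.orthogonalGroup m ℝ) (i : m) :
    ∑ k, P i k ^ 2 = 1 := by
  have h := congrFun₂ ((Matrix.mem_orthogonalGroup_iff m ℝ).1 hP) i i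
  simpa [Matrix.mul_apply, sq] using h

theorem inner_mul_mul_of_mem_orthogonalGroup (hP : P ∈ Matrix.orthogonalGroup m ℝ)
    (hQ : Q ∈ Matrix.orthogonalGroup n ℝ) (A B : Matrix m n ℝ) :
    ⟪P * A * Q, P * B * Q⟫_ℝ = ⟪A, B⟫_ℝ := by
  rw [inner_mul_right_eq, Matrix.mul_assoc (P * B), (Matrix.mem_orthogonalGroup_iff n ℝ).1 hQ,
    Matrix.mul_one, inner_mul_left_eq, ← Matrix.mul_assoc,
    transpose_mul_self_of_mem_orthogonalGroup hP, Matrix.one_mul]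

theorem norm_mul_mul_of_mem_orthogonalGroup (hP : P ∈ Matrix.orthogonalGroup m ℝ)
    (hQ : Q ∈ Matrix.orthogonalGroup n ℝ) (A : Matrix m n ℝ) : ‖P * A * Q‖ = ‖A‖ := by
  rw [← sq_eq_sq₀ (norm_nonneg _) (norm_nonneg _), ← real_inner_self_eq_norm_sq,
    inner_mul_mul_of_mem_orthogonalGroup hP hQ, real_inner_self_eq_norm_sq]

end Orthogonal

/-- `K` does not increase the Euclidean norm of vectors. -/
def IsContraction (K : Matrix l m ℝ) : Prop :=
  ∀ x, (K *ᵥ x) ⬝ᵥ (K *ᵥ x) ≤ x ⬝ᵥ x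

namespace IsContraction

theorem mul {K : Matrix l m ℝ} {L : Matrix m n ℝ} (hK : IsContraction K) (hL : IsContraction L) :
    IsContraction (K * L) := fun x => by
  rw [← Matrix.mulVec_mulVec]
  exact (hK _).trans (hL _)

theorem of_mem_orthogonalGroup [DecidableEq m] {P : Matrix m m ℝ}
    (hP : P ∈ Matrix.orthogonalGroup m ℝ) : IsContraction P := fun x => by
  rw [Matrix.dotProduct_mulVec, Matrix.vecMul_mulVec, transpose_mul_self_of_mem_orthogonalGroup hP,
    Matrix.vecMul_one]

theorem diagonal [DecidableEq m] {d : m → ℝ} (h0 : ∀ i, 0 ≤ d i) (h1 : ∀ i, d i ≤ 1) :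
    IsContraction (Matrix.diagonal d) := fun x => by
  refine Finset.sum_le_sum fun i _ => ?_
  rw [Matrix.mulVec_diagonal, mul_mul_mul_comm]
  exact mul_le_of_le_one_left (mul_self_nonneg _) (mul_le_one₀ (h1 i) (h0 i) (h1 i))

theorem norm_mul_le {K : Matrix l m ℝ} (hK : IsContraction K) (A : Matrix m n ℝ) :
    ‖K * A‖ ≤ ‖A‖ := by
  have h : ⟪(K * A)ᵀ, (K * A)ᵀ⟫_ℝ ≤ ⟪Aᵀ, Aᵀ⟫_ℝ := Finset.sum_le_sum fun j _ => hK (A.col j)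
  rw [inner_transpose, inner_transpose, real_inner_self_eq_norm_sq,
    real_inner_self_eq_norm_sq] at h
  exact (sq_le_sq₀ (norm_nonneg _) (norm_nonneg _)).1 h

theorem norm_mul_transpose_le {L : Matrix l n ℝ} (hL : IsContraction L) (A : Matrix m n ℝ) :
    ‖A * Lᵀ‖ ≤ ‖A‖ := by
  rw [← Matrix.frobenius_norm_transpose, Matrix.transpose_mul, Matrix.transpose_transpose,
    ← Matrix.frobenius_norm_transpose A]
  exact hL.norm_mul_le Aᵀ

end IsContraction

/-- The operator `Z ↦ K * Z * L`; both parts of the weight operator have this form. -/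
def mulLeftRight (K : Matrix m m ℝ) (L : Matrix n n ℝ) : Matrix m n ℝ →ₗ[ℝ] Matrix m n ℝ where
  toFun Z := K * Z * L
  map_add' A B := by rw [Matrix.mul_add, Matrix.add_mul]
  map_smul' c A := by rw [Matrix.mul_smul, Matrix.smul_mul, RingHom.id_apply]

section mulLeftRight

variable {K : Matrix m m ℝ} {L : Matrix n n ℝ}

@[simp]
theorem mulLeftRight_apply (Z : Matrix m n ℝ) : mulLeftRight K L Z = K * Z * L := rfl

theorem isSymmetric_mulLeftRight (hK : K.IsSymm) (hL : L.IsSymm) :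
    (mulLeftRight K L).IsSymmetric := fun A B => by
  change ⟪K * A * L, B⟫_ℝ = ⟪A, K * B * L⟫_ℝ
  rw [inner_mul_right_eq, inner_mul_left_eq, hK.eq, hL.eq, Matrix.mul_assoc]

theorem norm_mulLeftRight_le (hK : IsContraction K) (hL : IsContraction L) (hL' : L.IsSymm)
    (A : Matrix m n ℝ) : ‖mulLeftRight K L A‖ ≤ ‖A‖ := by
  rw [mulLeftRight_apply, ← hL'.eq]
  exact (hL.norm_mul_transpose_le _).trans (hK.norm_mul_le _)

end mulLeftRight

end FrobeniusInner

attribute [local instance] frobeniusInnerProductSpace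

/-! ### Hadamard's inequality -/

theorem abs_det_le_prod_norm_col {n : ℕ} (M : Matrix (Fin n) (Fin n) ℝ) :
    |M.det| ≤ ∏ j, ‖WithLp.toLp 2 (M.col j)‖ := by
  have : Fact (Module.finrank ℝ (EuclideanSpace ℝ (Fin n)) = n) := ⟨by simp⟩
  let b := EuclideanSpace.basisFun (Fin n) ℝ
  have h := b.toBasis.orientation.abs_volumeForm_apply_le fun j => WithLp.toLp 2 (M.col j)
  rw [b.toBasis.orientation.volumeForm_robust' b, Module.Basis.det_apply] at h
  have hM : (b.toBasis.toMatrix fun j => WithLp.toLp 2 (M.col j)) = M := by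
    ext i j
    simp [b, Module.Basis.toMatrix_apply]
  rwa [hM] at h

theorem sq_det_le_prod_transpose_mul_self {n : ℕ} (M : Matrix (Fin n) (Fin n) ℝ) :
    M.det ^ 2 ≤ ∏ j, (Mᵀ * M) j j := by
  have hcol (j : Fin n) : ‖WithLp.toLp 2 (M.col j)‖ ^ 2 = (Mᵀ * M) j j := by
    rw [EuclideanSpace.real_norm_sq_eq]
    exact Finset.sum_congr rfl fun i _ => sq (M i j)
  have h := pow_le_pow_left₀ (abs_nonneg _) (abs_det_le_prod_norm_col M) 2
  rw [sq_abs, ← Finset.prod_pow] at h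
  simpa only [hcol] using h

theorem transpose_mul_self_apply_pos {n : ℕ} {M : Matrix (Fin n) (Fin n) ℝ} (hM : M.det ≠ 0)
    (j : Fin n) : 0 < (Mᵀ * M) j j := by
  have hnonneg : 0 ≤ (Mᵀ * M) j j := by
    rw [Matrix.mul_apply]
    exact Finset.sum_nonneg fun i _ => mul_self_nonneg (M i j)
  refine hnonneg.lt_of_ne' fun h => hM ?_
  have hdet := sq_det_le_prod_transpose_mul_self M
  rw [Finset.prod_eq_zero (f := fun j => (Mᵀ * M) j j) (Finset.mem_univ j) h] at hdet
  exact pow_eq_zero_iff two_ne_zero |>.1 (le_antisymm hdet (sq_nonneg _))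

theorem two_mul_log_abs_det_le {n : ℕ} {M : Matrix (Fin n) (Fin n) ℝ} (hM : M.det ≠ 0) :
    2 * Real.log |M.det| ≤ ∑ j, Real.log ((Mᵀ * M) j j) := by
  have h := Real.log_le_log (by positivity) (sq_det_le_prod_transpose_mul_self M)
  rwa [Real.log_prod fun j _ => (transpose_mul_self_apply_pos hM j).ne', Real.log_pow,
    ← Real.log_abs, Nat.cast_two] at h

/-! ### Rectangular diagonal matrices -/

/-- The rectangular diagonal matrix with diagonal `s`. Indexing `s` by `ℕ` lets the same sequence
serve for both shapes `n₁ × n₂` and `n₂ × n₁`. -/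
def rectDiag (n₁ n₂ : ℕ) (s : ℕ → ℝ) : Matrix (Fin n₁) (Fin n₂) ℝ :=
  Matrix.of fun i j => if (i : ℕ) = j then s i else 0

section rectDiag

variable {n₁ n₂ : ℕ} {s : ℕ → ℝ}

theorem rectDiag_apply (s : ℕ → ℝ) (i : Fin n₁) (j : Fin n₂) :
    rectDiag n₁ n₂ s i j = if (i : ℕ) = j then s i else 0 := rfl

theorem rectDiag_transpose (n₁ n₂ : ℕ) (s : ℕ → ℝ) :
    (rectDiag n₁ n₂ s)ᵀ = rectDiag n₂ n₁ s := by
  ext i j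
  simp only [rectDiag_apply, Matrix.transpose_apply, eq_comm (a := (j : ℕ))]
  split_ifs with h <;> simp [h]

theorem rectDiag_mul_rectDiag_apply (c s : ℕ → ℝ) (i : Fin n₁) (j : Fin n₂) :
    rectDiag n₁ n₂ c i j * rectDiag n₁ n₂ s i j = rectDiag n₁ n₂ (fun i => c i * s i) i j := by
  simp only [rectDiag_apply]
  split_ifs <;> simp

theorem sum_rectDiag_row (hs : ∀ i, n₂ ≤ i → s i = 0) (i : Fin n₁) :
    ∑ j, rectDiag n₁ n₂ s i j = s i := by
  rcases lt_or_ge (i : ℕ) n₂ with h | h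
  · have hij (j : Fin n₂) : (i : ℕ) = j ↔ j = ⟨i, h⟩ := by rw [Fin.ext_iff, eq_comm]
    simp only [rectDiag_apply, hij, Finset.sum_ite_eq', Finset.mem_univ, if_true]
  · rw [hs i h]
    exact Finset.sum_eq_zero fun j _ => by rw [rectDiag_apply, hs i h, ite_self]

theorem sum_rectDiag_col (hs : ∀ i, n₁ ≤ i → s i = 0) (j : Fin n₂) :
    ∑ i, rectDiag n₁ n₂ s i j = s j := by
  rw [← sum_rectDiag_row hs j, ← rectDiag_transpose]
  rfl

theorem sum_fin_eq_sum_fin (hs₁ : ∀ i, n₁ ≤ i → s i = 0) (hs₂ : ∀ i, n₂ ≤ i → s i = 0) :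
    ∑ i : Fin n₁, s i = ∑ j : Fin n₂, s j := by
  calc ∑ i : Fin n₁, s i
      = ∑ i : Fin n₁, ∑ j, rectDiag n₁ n₂ s i j := by simp only [sum_rectDiag_row hs₂]
    _ = ∑ j, ∑ i, rectDiag n₁ n₂ s i j := Finset.sum_comm
    _ = ∑ j : Fin n₂, s j := by simp only [sum_rectDiag_col hs₁]

theorem rectDiag_mul_transpose_self (hs : ∀ i, n₂ ≤ i → s i = 0) :
    rectDiag n₁ n₂ s * (rectDiag n₁ n₂ s)ᵀ = Matrix.diagonal fun i : Fin n₁ => s i ^ 2 := by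
  ext i k
  rw [Matrix.mul_apply, Matrix.diagonal_apply]
  split_ifs with hik
  · rw [hik, ← sum_rectDiag_row (s := fun i => s i ^ 2) fun i hi => by simp [hs i hi]]
    exact Finset.sum_congr rfl fun j _ => by
      simp only [Matrix.transpose_apply, rectDiag_mul_rectDiag_apply, sq]
  · refine Finset.sum_eq_zero fun j _ => ?_
    rcases ne_or_eq (i : ℕ) j with hij | hij
    · rw [rectDiag_apply, if_neg hij, zero_mul]
    · rw [Matrix.transpose_apply, rectDiag_apply s k, if_neg fun hkj => hik (Fin.ext (by omega)),
        mul_zero]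

theorem norm_sq_mul_rectDiag {l : Type*} [Fintype l] (M : Matrix l (Fin n₁) ℝ)
    (hs : ∀ i, n₂ ≤ i → s i = 0) :
    ‖M * rectDiag n₁ n₂ s‖ ^ 2 = ∑ j : Fin n₁, (Mᵀ * M) j j * s j ^ 2 := by
  rw [← real_inner_self_eq_norm_sq, inner_mul_right_eq, Matrix.mul_assoc,
    rectDiag_mul_transpose_self hs, real_inner_comm, inner_mul_left_eq, inner_eq_trace,
    Matrix.diagonal_transpose]
  simp [Matrix.trace, Matrix.diagonal_mul, mul_comm]

end rectDiag

/-! ### Singular value decomposition -/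

/-- `Y = U * diag s * Vᵀ` is a singular value decomposition (with `s` not necessarily sorted). -/
structure IsSVD {n₁ n₂ : ℕ} (Y : Matrix (Fin n₁) (Fin n₂) ℝ) (U : Matrix (Fin n₁) (Fin n₁) ℝ)
    (V : Matrix (Fin n₂) (Fin n₂) ℝ) (s : ℕ → ℝ) : Prop where
  left_orthogonal : U ∈ Matrix.orthogonalGroup (Fin n₁) ℝ
  right_orthogonal : V ∈ Matrix.orthogonalGroup (Fin n₂) ℝ
  eq : Y = U * rectDiag n₁ n₂ s * Vᵀ
  nonneg : ∀ i, 0 ≤ s i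
  left_zero : ∀ i, n₁ ≤ i → s i = 0
  right_zero : ∀ i, n₂ ≤ i → s i = 0

theorem inner_map_eigenvectorBasis {E E' : Type*} [NormedAddCommGroup E] [InnerProductSpace ℝ E]
    [FiniteDimensional ℝ E] [NormedAddCommGroup E'] [InnerProductSpace ℝ E']
    [FiniteDimensional ℝ E'] (T : E →ₗ[ℝ] E') {n : ℕ} (hn : Module.finrank ℝ E = n)
    (i j : Fin n) :
    ⟪T (T.isSymmetric_adjoint_comp_self.eigenvectorBasis hn i),
      T (T.isSymmetric_adjoint_comp_self.eigenvectorBasis hn j)⟫_ℝ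
        = if i = j then T.singularValues i ^ 2 else 0 := by
  have heigen := T.isSymmetric_adjoint_comp_self.apply_eigenvectorBasis hn j
  rw [LinearMap.comp_apply] at heigen
  rw [← LinearMap.adjoint_inner_right, heigen, inner_smul_right,
    orthonormal_iff_ite.1 (OrthonormalBasis.orthonormal _) i j, ← T.sq_singularValues_fin hn]
  split_ifs with h
  · subst h
    simp
  · simp

theorem exists_orthonormalBasis_eq_sum_rectDiag {E : Type*} [NormedAddCommGroup E]
    [InnerProductSpace ℝ E] {n₁ n₂ : ℕ} [FiniteDimensional ℝ E] (hn : Module.finrank ℝ E = n₁)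
    {s : ℕ → ℝ} (hs₁ : ∀ i, n₁ ≤ i → s i = 0) (hs₂ : ∀ i, n₂ ≤ i → s i = 0) {w : Fin n₂ → E}
    (hw : ∀ i j, ⟪w i, w j⟫_ℝ = if i = j then s i ^ 2 else 0) :
    ∃ a : OrthonormalBasis (Fin n₁) ℝ E, ∀ j, w j = ∑ i, rectDiag n₁ n₂ s i j • a i := by
  let v : Fin n₁ → E := fun i => if h : (i : ℕ) < n₂ then (s i)⁻¹ • w ⟨i, h⟩ else 0
  let S : Set (Fin n₁) := {i | s i ≠ 0}
  have hS (i : Fin n₁) (hi : i ∈ S) : (i : ℕ) < n₂ := not_le.1 fun h => hi (hs₂ i h)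
  have hv : Orthonormal ℝ (S.domRestrict v) := by
    rw [orthonormal_iff_ite]
    rintro ⟨i, hi⟩ ⟨j, hj⟩
    have hi' : s i ≠ 0 := hi
    simp only [Set.domRestrict_apply, v, dif_pos (hS i hi), dif_pos (hS j hj), inner_smul_left,
      inner_smul_right, hw, Subtype.mk.injEq, Fin.mk.injEq, Fin.val_inj]
    split_ifs with h
    · subst h
      simp only [map_inv₀, conj_trivial]
      field_simp
    · simp
  obtain ⟨a, ha⟩ := hv.exists_orthonormalBasis_extension_of_card_eq (by simp [hn])
  refine ⟨a, fun j => ?_⟩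
  by_cases h0 : s j = 0
  · have hwj : w j = 0 := by
      rw [← inner_self_eq_zero (𝕜 := ℝ), hw, if_pos rfl, h0, zero_pow two_ne_zero]
    rw [hwj, Finset.sum_eq_zero]
    intro i _
    rw [rectDiag_apply]
    split_ifs with h <;> simp [h, h0]
  · have hj : (j : ℕ) < n₁ := not_le.1 fun h => h0 (hs₁ j h)
    rw [Finset.sum_eq_single_of_mem ⟨j, hj⟩ (Finset.mem_univ _) fun i _ hi => by
      rw [rectDiag_apply, if_neg fun e => hi (Fin.ext e), zero_smul],
      ha ⟨j, hj⟩ h0, rectDiag_apply, if_pos rfl]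
    simp only [v, dif_pos j.2]
    rw [smul_smul, mul_inv_cancel₀ h0, one_smul]

/-- The matrix whose columns are the vectors of the orthonormal basis `b`. -/
noncomputable def basisMatrix {n : ℕ} (b : OrthonormalBasis (Fin n) ℝ (EuclideanSpace ℝ (Fin n))) :
    Matrix (Fin n) (Fin n) ℝ :=
  Matrix.of fun i j => b j i

theorem basisMatrix_mem_orthogonalGroup {n : ℕ}
    (b : OrthonormalBasis (Fin n) ℝ (EuclideanSpace ℝ (Fin n))) :
    basisMatrix b ∈ Matrix.orthogonalGroup (Fin n) ℝ := by
  rw [Matrix.mem_orthogonalGroup_iff']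
  ext i j
  have h := orthonormal_iff_ite.1 b.orthonormal i j
  rw [PiLp.inner_apply] at h
  simpa [Matrix.mul_apply, basisMatrix, Matrix.one_apply, mul_comm] using h

section sing

variable {n₁ n₂ : ℕ} (X : Matrix (Fin n₁) (Fin n₂) ℝ)

theorem sing_nonneg (i : ℕ) : 0 ≤ sing X i :=
  LinearMap.singularValues_nonneg _ _

theorem sing_of_right_le {i : ℕ} (hi : n₂ ≤ i) : sing X i = 0 :=
  LinearMap.singularValues_of_finrank_le _ (by simpa using hi)

theorem sing_of_left_le {i : ℕ} (hi : n₁ ≤ i) : sing X i = 0 := by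
  rw [sing, LinearMap.singularValues_eq_zero_iff_le_finrank_range]
  refine le_trans ?_ hi
  simpa using Submodule.finrank_le (Matrix.toEuclideanLin X).range

theorem sum_sing_eq_sum_sing {g : ℝ → ℝ} (hg : g 0 = 0) :
    ∑ i : Fin n₁, g (sing X i) = ∑ j : Fin n₂, g (sing X j) :=
  sum_fin_eq_sum_fin (s := fun i => g (sing X i)) (fun i hi => by simp [sing_of_left_le X hi, hg])
    fun i hi => by simp [sing_of_right_le X hi, hg]

theorem exists_isSVD : ∃ U V, IsSVD X U V (sing X) := by
  set T := Matrix.toEuclideanLin X with hT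
  have hn : Module.finrank ℝ (EuclideanSpace ℝ (Fin n₂)) = n₂ := by simp
  let b := T.isSymmetric_adjoint_comp_self.eigenvectorBasis hn
  have horth (i j : Fin n₂) : ⟪T (b i), T (b j)⟫_ℝ = if i = j then sing X i ^ 2 else 0 :=
    inner_map_eigenvectorBasis T hn i j
  obtain ⟨a, ha⟩ := exists_orthonormalBasis_eq_sum_rectDiag
    (E := EuclideanSpace ℝ (Fin n₁)) (n₁ := n₁) finrank_euclideanSpace_fin
    (fun i => sing_of_left_le X) (fun i => sing_of_right_le X) (w := fun j => T (b j)) horth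
  have hXV : X * basisMatrix b = basisMatrix a * rectDiag n₁ n₂ (sing X) := by
    ext i j
    have hentry : (X * basisMatrix b) i j = T (b j) i := by
      simp [hT, Matrix.mul_apply, basisMatrix, Matrix.toLpLin_apply, Matrix.mulVec, dotProduct]
    rw [hentry, ha, Matrix.mul_apply]
    simp [basisMatrix, mul_comm]
  have hb := basisMatrix_mem_orthogonalGroup b
  refine ⟨basisMatrix a, basisMatrix b, basisMatrix_mem_orthogonalGroup a, hb, ?_, sing_nonneg X,
    fun i => sing_of_left_le X, fun i => sing_of_right_le X⟩
  rw [← hXV, Matrix.mul_assoc, (Matrix.mem_orthogonalGroup_iff _ ℝ).1 hb, Matrix.mul_one]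

end sing

namespace IsSVD

variable {n₁ n₂ : ℕ} {Y : Matrix (Fin n₁) (Fin n₂) ℝ} {U : Matrix (Fin n₁) (Fin n₁) ℝ}
  {V : Matrix (Fin n₂) (Fin n₂) ℝ} {s : ℕ → ℝ}

theorem transpose (h : IsSVD Y U V s) : IsSVD Yᵀ V U s where
  left_orthogonal := h.right_orthogonal
  right_orthogonal := h.left_orthogonal
  eq := by
    rw [h.eq, Matrix.transpose_mul, Matrix.transpose_mul, rectDiag_transpose,
      Matrix.transpose_transpose, Matrix.mul_assoc]
  nonneg := h.nonneg
  left_zero := h.right_zero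
  right_zero := h.left_zero

theorem mul_right_eq (h : IsSVD Y U V s) : Y * V = U * rectDiag n₁ n₂ s := by
  rw [h.eq, Matrix.mul_assoc, transpose_mul_self_of_mem_orthogonalGroup h.right_orthogonal,
    Matrix.mul_one]

theorem transpose_mul_mul_eq (h : IsSVD Y U V s) : Uᵀ * Y * V = rectDiag n₁ n₂ s := by
  rw [Matrix.mul_assoc, h.mul_right_eq, ← Matrix.mul_assoc,
    transpose_mul_self_of_mem_orthogonalGroup h.left_orthogonal, Matrix.one_mul]

theorem norm_sq_mul (h : IsSVD Y U V s) {l : Type*} [Fintype l] (K : Matrix l (Fin n₁) ℝ) :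
    ‖K * Y‖ ^ 2 = ∑ j : Fin n₁, ((K * U)ᵀ * (K * U)) j j * s j ^ 2 := by
  have hrot : K * Y = K * U * rectDiag n₁ n₂ s * Vᵀ := by
    rw [h.eq]
    simp only [Matrix.mul_assoc]
  rw [← norm_sq_mul_rectDiag _ h.right_zero, hrot, ← real_inner_self_eq_norm_sq,
    inner_mul_right_eq, Matrix.mul_assoc _ Vᵀ, Matrix.transpose_transpose,
    transpose_mul_self_of_mem_orthogonalGroup h.right_orthogonal, Matrix.mul_one,
    real_inner_self_eq_norm_sq]

theorem norm_sq (h : IsSVD Y U V s) : ‖Y‖ ^ 2 = ∑ j : Fin n₁, s j ^ 2 := by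
  have h1 := h.norm_sq_mul (1 : Matrix (Fin n₁) (Fin n₁) ℝ)
  simp only [Matrix.one_mul, transpose_mul_self_of_mem_orthogonalGroup h.left_orthogonal,
    Matrix.one_apply_eq, one_mul] at h1
  exact h1

end IsSVD

/-! ### Variational formula for the low-rank objective -/

section DiagonalMulTranspose

variable {n : Type*} [Fintype n] [DecidableEq n] {P : Matrix n n ℝ} {d : n → ℝ}

theorem isContraction_diagonal_mul_transpose (hP : P ∈ Matrix.orthogonalGroup n ℝ)
    (h0 : ∀ i, 0 ≤ d i) (h1 : ∀ i, d i ≤ 1) : IsContraction (Matrix.diagonal d * Pᵀ) :=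
  (IsContraction.diagonal h0 h1).mul
    (.of_mem_orthogonalGroup (transpose_mem_orthogonalGroup hP))

theorem abs_det_diagonal_mul_transpose (hP : P ∈ Matrix.orthogonalGroup n ℝ) :
    |(Matrix.diagonal d * Pᵀ).det| = |∏ i, d i| := by
  rw [Matrix.det_mul, abs_mul, Matrix.det_transpose, abs_det_of_mem_orthogonalGroup hP, mul_one,
    Matrix.det_diagonal]

theorem det_diagonal_mul_transpose_ne_zero (hP : P ∈ Matrix.orthogonalGroup n ℝ)
    (hd : ∀ i, d i ≠ 0) : (Matrix.diagonal d * Pᵀ).det ≠ 0 := by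
  rw [← abs_ne_zero, abs_det_diagonal_mul_transpose hP, abs_ne_zero]
  exact Finset.prod_ne_zero_iff.2 fun i _ => hd i

theorem log_abs_det_diagonal_mul_transpose (hP : P ∈ Matrix.orthogonalGroup n ℝ)
    (hd : ∀ i, d i ≠ 0) :
    Real.log |(Matrix.diagonal d * Pᵀ).det| = ∑ i, Real.log (d i) := by
  rw [abs_det_diagonal_mul_transpose hP, Real.log_abs, Real.log_prod fun i _ => hd i]

end DiagonalMulTranspose

section Variational

variable {n₁ n₂ : ℕ} {Y Z : Matrix (Fin n₁) (Fin n₂) ℝ} {U A K : Matrix (Fin n₁) (Fin n₁) ℝ}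
  {V B L : Matrix (Fin n₂) (Fin n₂) ℝ} {s t : ℕ → ℝ} {τ : ℝ}

theorem IsSVD.sum_fSmooth_le (hτ : 0 < τ) (h : IsSVD Y U V s) (hK : IsContraction K)
    (hdet : K.det ≠ 0) :
    ∑ j : Fin n₁, fSmooth τ (s j) ≤ 1 / 2 * ‖K * Y‖ ^ 2 - τ ^ 2 * Real.log |K.det| := by
  have hdetU : |(K * U).det| = |K.det| := by
    rw [Matrix.det_mul, abs_mul, abs_det_of_mem_orthogonalGroup h.left_orthogonal, mul_one]
  have hdetU_ne : (K * U).det ≠ 0 := by rwa [← abs_ne_zero, hdetU, abs_ne_zero]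
  have hlog := two_mul_log_abs_det_le hdetU_ne
  rw [hdetU] at hlog
  have hle_one (j : Fin n₁) : ((K * U)ᵀ * (K * U)) j j ≤ 1 := by
    have hcol : ((K * U)ᵀ * (K * U)) j j ≤ (Uᵀ * U) j j := hK (U.col j)
    rwa [transpose_mul_self_of_mem_orthogonalGroup h.left_orthogonal, Matrix.one_apply_eq] at hcol
  rw [h.norm_sq_mul]
  set μ : Fin n₁ → ℝ := fun j => ((K * U)ᵀ * (K * U)) j j
  calc ∑ j : Fin n₁, fSmooth τ (s j)
      ≤ ∑ j : Fin n₁, (1 / 2 * μ j * s j ^ 2 - 1 / 2 * τ ^ 2 * Real.log (μ j)) :=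
        Finset.sum_le_sum fun j _ => fSmooth_le hτ (h.nonneg j)
          (transpose_mul_self_apply_pos hdetU_ne j) (hle_one j)
    _ = 1 / 2 * ∑ j : Fin n₁, μ j * s j ^ 2 - 1 / 2 * τ ^ 2 * ∑ j, Real.log (μ j) := by
        simp only [Finset.sum_sub_distrib, Finset.mul_sum, mul_assoc]
    _ ≤ _ := by linarith [mul_le_mul_of_nonneg_left hlog (sq_nonneg τ)]

theorem sum_fSmooth_eq {ι : Type*} [Fintype ι] {s : ι → ℝ} (hτ : 0 < τ) (hs : ∀ j, 0 ≤ s j) :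
    ∑ j, fSmooth τ (s j) = 1 / 2 * ∑ j, sqrtWeight τ (s j) ^ 2 * s j ^ 2
      - τ ^ 2 * ∑ j, Real.log (sqrtWeight τ (s j)) := by
  simp only [fSmooth_eq_sqrtWeight hτ (hs _), Finset.sum_sub_distrib, Finset.mul_sum, mul_assoc]

theorem IsSVD.exists_sum_fSmooth_eq (hτ : 0 < τ) (h : IsSVD Y U V s) :
    ∃ K : Matrix (Fin n₁) (Fin n₁) ℝ, IsContraction K ∧ K.det ≠ 0 ∧
      ∑ j : Fin n₁, fSmooth τ (s j) = 1 / 2 * ‖K * Y‖ ^ 2 - τ ^ 2 * Real.log |K.det| := by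
  have hw (j : Fin n₁) : sqrtWeight τ (s j) ≠ 0 := (sqrtWeight_pos _ _).ne'
  refine ⟨Matrix.diagonal (fun j : Fin n₁ => sqrtWeight τ (s j)) * Uᵀ,
    isContraction_diagonal_mul_transpose h.left_orthogonal (fun _ => (sqrtWeight_pos _ _).le)
      fun _ => sqrtWeight_le_one _ _,
    det_diagonal_mul_transpose_ne_zero h.left_orthogonal hw, ?_⟩
  rw [h.norm_sq_mul, Matrix.mul_assoc, transpose_mul_self_of_mem_orthogonalGroup h.left_orthogonal,
    Matrix.mul_one, log_abs_det_diagonal_mul_transpose h.left_orthogonal hw,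
    sum_fSmooth_eq hτ fun j : Fin n₁ => h.nonneg j]
  simp only [Matrix.diagonal_transpose, Matrix.diagonal_mul_diagonal, Matrix.diagonal_apply_eq, sq]

theorem IsSVD.sum_fSmooth_le_of_mul (hτ : 0 < τ) (h : IsSVD Y U V s) (hK : IsContraction K)
    (hdet : K.det ≠ 0) (h' : IsSVD (K * Y) A B t) :
    ∑ j : Fin n₁, fSmooth τ (s j)
      ≤ ∑ j : Fin n₁, fSmooth τ (t j) - τ ^ 2 * Real.log |K.det| := by
  obtain ⟨M, hM, hMdet, heq⟩ := h'.exists_sum_fSmooth_eq hτ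
  have hle := h.sum_fSmooth_le hτ (hM.mul hK)
    (by rw [Matrix.det_mul]; exact mul_ne_zero hMdet hdet)
  rw [Matrix.mul_assoc, Matrix.det_mul, abs_mul,
    Real.log_mul (abs_ne_zero.2 hMdet) (abs_ne_zero.2 hdet)] at hle
  linarith

theorem Flr_eq_sum_left (τ : ℝ) (Z : Matrix (Fin n₁) (Fin n₂) ℝ) :
    Flr τ Z = ∑ i : Fin n₁, fSmooth τ (sing Z i) := by
  rw [Flr, Finset.sum_range]
  exact sum_fin_eq_sum_fin (s := fun i => fSmooth τ (sing Z i)) (fun i hi => by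
    rcases min_le_iff.1 hi with hi | hi <;> simp [sing_of_left_le Z, sing_of_right_le Z, hi])
    fun i hi => by simp [sing_of_left_le Z hi]

theorem Flr_eq_sum_right (τ : ℝ) (Z : Matrix (Fin n₁) (Fin n₂) ℝ) :
    Flr τ Z = ∑ j : Fin n₂, fSmooth τ (sing Z j) :=
  (Flr_eq_sum_left τ Z).trans (sum_sing_eq_sum_sing Z (fSmooth_apply_zero τ))

theorem Flr_le_Flr_mul_left (hτ : 0 < τ) (hK : IsContraction K) (hdet : K.det ≠ 0)
    (Z : Matrix (Fin n₁) (Fin n₂) ℝ) :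
    Flr τ Z ≤ Flr τ (K * Z) - τ ^ 2 * Real.log |K.det| := by
  obtain ⟨U, V, h⟩ := exists_isSVD Z
  obtain ⟨A, B, h'⟩ := exists_isSVD (K * Z)
  rw [Flr_eq_sum_left, Flr_eq_sum_left]
  exact h.sum_fSmooth_le_of_mul hτ hK hdet h'

theorem Flr_le_Flr_mul_right (hτ : 0 < τ) (hL : IsContraction L) (hdet : L.det ≠ 0)
    (Z : Matrix (Fin n₁) (Fin n₂) ℝ) :
    Flr τ Z ≤ Flr τ (Z * Lᵀ) - τ ^ 2 * Real.log |L.det| := by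
  obtain ⟨U, V, h⟩ := exists_isSVD Z
  obtain ⟨A, B, h'⟩ := exists_isSVD (Z * Lᵀ)
  have h'T := h'.transpose
  rw [Matrix.transpose_mul, Matrix.transpose_transpose] at h'T
  rw [Flr_eq_sum_right, Flr_eq_sum_right]
  exact h.transpose.sum_fSmooth_le_of_mul hτ hL hdet h'T

theorem Flr_le_half_norm_sq (hτ : 0 < τ) (Z : Matrix (Fin n₁) (Fin n₂) ℝ) :
    Flr τ Z ≤ 1 / 2 * ‖Z‖ ^ 2 := by
  obtain ⟨U, V, h⟩ := exists_isSVD Z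
  have hle := h.sum_fSmooth_le (K := 1) hτ (.of_mem_orthogonalGroup (one_mem _)) (by simp)
  rw [Flr_eq_sum_left]
  simpa only [Matrix.one_mul, Matrix.det_one, abs_one, Real.log_one, mul_zero, sub_zero] using hle

end Variational

/-! ### The low-rank weight as a majorizer -/

/-- `Wlr X ε U V` as a linear map. -/
noncomputable def lowRankWeight {n₁ n₂ : ℕ} (X : Matrix (Fin n₁) (Fin n₂) ℝ) (ε : ℝ)
    (U : Matrix (Fin n₁) (Fin n₁) ℝ) (V : Matrix (Fin n₂) (Fin n₂) ℝ) :
    Matrix (Fin n₁) (Fin n₂) ℝ →ₗ[ℝ] Matrix (Fin n₁) (Fin n₂) ℝ :=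
  mulLeftRight (U * sigmaInv X ε n₁ * Uᵀ) (V * sigmaInv X ε n₂ * Vᵀ)

/-- A matrix `K` with `Kᵀ * K = P * sigmaInv X ε n * Pᵀ`; the low-rank weight is
`Z ↦ Kᵀ * K * Z * Lᵀ * L` for the factors `K` of `U` and `L` of `V`. -/
noncomputable def lowRankFactor {n₁ n₂ n : ℕ} (X : Matrix (Fin n₁) (Fin n₂) ℝ) (ε : ℝ)
    (P : Matrix (Fin n) (Fin n) ℝ) : Matrix (Fin n) (Fin n) ℝ :=
  Matrix.diagonal (fun i : Fin n => √(sqrtWeight ε (sing X i))) * Pᵀ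

section lowRankFactor

variable {n₁ n₂ n : ℕ} (X : Matrix (Fin n₁) (Fin n₂) ℝ) (ε : ℝ) {P : Matrix (Fin n) (Fin n) ℝ}

theorem isContraction_lowRankFactor (hP : P ∈ Matrix.orthogonalGroup (Fin n) ℝ) :
    IsContraction (lowRankFactor X ε P) :=
  isContraction_diagonal_mul_transpose hP (fun _ => Real.sqrt_nonneg _) fun _ =>
    Real.sqrt_le_one.2 (sqrtWeight_le_one _ _)

theorem det_lowRankFactor_ne_zero (hP : P ∈ Matrix.orthogonalGroup (Fin n) ℝ) :
    (lowRankFactor X ε P).det ≠ 0 :=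
  det_diagonal_mul_transpose_ne_zero hP fun _ => (Real.sqrt_pos.2 (sqrtWeight_pos _ _)).ne'

theorem log_abs_det_lowRankFactor (hP : P ∈ Matrix.orthogonalGroup (Fin n) ℝ) :
    Real.log |(lowRankFactor X ε P).det|
      = 1 / 2 * ∑ i : Fin n, Real.log (sqrtWeight ε (sing X i)) := by
  rw [lowRankFactor, log_abs_det_diagonal_mul_transpose hP fun _ =>
    (Real.sqrt_pos.2 (sqrtWeight_pos _ _)).ne', Finset.mul_sum]
  refine Finset.sum_congr rfl fun i _ => ?_
  rw [Real.log_sqrt (sqrtWeight_pos _ _).le]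
  ring

theorem isSymm_mul_sigmaInv_mul_transpose (P : Matrix (Fin n) (Fin n) ℝ) :
    (P * sigmaInv X ε n * Pᵀ).IsSymm := by
  rw [Matrix.IsSymm, Matrix.transpose_mul, Matrix.transpose_mul, Matrix.transpose_transpose,
    sigmaInv, Matrix.diagonal_transpose, Matrix.mul_assoc]

theorem isContraction_mul_sigmaInv_mul_transpose (hP : P ∈ Matrix.orthogonalGroup (Fin n) ℝ) :
    IsContraction (P * sigmaInv X ε n * Pᵀ) :=
  ((IsContraction.of_mem_orthogonalGroup hP).mul (.diagonal
    (fun _ => (sqrtWeight_pos _ _).le) fun _ => sqrtWeight_le_one _ _)).mul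
    (.of_mem_orthogonalGroup (transpose_mem_orthogonalGroup hP))

end lowRankFactor

section lowRankWeight

variable {n₁ n₂ : ℕ} (X : Matrix (Fin n₁) (Fin n₂) ℝ) (ε : ℝ)
  (U : Matrix (Fin n₁) (Fin n₁) ℝ) (V : Matrix (Fin n₂) (Fin n₂) ℝ)

theorem lowRankWeight_apply (Z : Matrix (Fin n₁) (Fin n₂) ℝ) :
    lowRankWeight X ε U V Z = Wlr X ε U V Z := by
  simp only [lowRankWeight, mulLeftRight_apply, Wlr, Matrix.mul_assoc]

theorem isSymmetric_lowRankWeight : (lowRankWeight X ε U V).IsSymmetric :=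
  isSymmetric_mulLeftRight (isSymm_mul_sigmaInv_mul_transpose X ε U)
    (isSymm_mul_sigmaInv_mul_transpose X ε V)

theorem inner_lowRankWeight (Z : Matrix (Fin n₁) (Fin n₂) ℝ) :
    ⟪Z, lowRankWeight X ε U V Z⟫_ℝ = ∑ i : Fin n₁, ∑ j : Fin n₂,
      sqrtWeight ε (sing X i) * sqrtWeight ε (sing X j) * (Uᵀ * Z * V) i j ^ 2 := by
  have hrot : lowRankWeight X ε U V Z
      = U * (sigmaInv X ε n₁ * (Uᵀ * Z * V) * sigmaInv X ε n₂) * Vᵀ := by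
    simp only [lowRankWeight, mulLeftRight_apply, Matrix.mul_assoc]
  rw [hrot, real_inner_comm, inner_mul_right_eq, inner_mul_left_eq, Matrix.transpose_transpose,
    ← Matrix.mul_assoc Uᵀ, inner_eq_sum]
  refine Finset.sum_congr rfl fun i _ => Finset.sum_congr rfl fun j _ => ?_
  rw [sigmaInv, sigmaInv, Matrix.mul_diagonal, Matrix.diagonal_mul, sqrtWeight, sqrtWeight]
  ring

theorem norm_sq_lowRankFactor_mul_mul (Z : Matrix (Fin n₁) (Fin n₂) ℝ) :
    ‖lowRankFactor X ε U * Z * (lowRankFactor X ε V)ᵀ‖ ^ 2 = ⟪Z, lowRankWeight X ε U V Z⟫_ℝ := by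
  rw [inner_lowRankWeight, norm_sq_eq_sum]
  refine Finset.sum_congr rfl fun i _ => Finset.sum_congr rfl fun j _ => ?_
  rw [lowRankFactor, lowRankFactor, Matrix.transpose_mul, Matrix.transpose_transpose,
    Matrix.diagonal_transpose, ← Matrix.mul_assoc, Matrix.mul_diagonal, Matrix.mul_assoc,
    Matrix.mul_assoc, Matrix.diagonal_mul, ← Matrix.mul_assoc Uᵀ, mul_pow, mul_pow,
    Real.sq_sqrt (sqrtWeight_pos _ _).le, Real.sq_sqrt (sqrtWeight_pos _ _).le]
  ring

end lowRankWeight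

namespace IsSingularBases

variable {n₁ n₂ : ℕ} {X : Matrix (Fin n₁) (Fin n₂) ℝ} {ε : ℝ}
  {U : Matrix (Fin n₁) (Fin n₁) ℝ} {V : Matrix (Fin n₂) (Fin n₂) ℝ}

theorem norm_lowRankWeight_le (h : IsSingularBases X ε U V) (Z : Matrix (Fin n₁) (Fin n₂) ℝ) :
    ‖lowRankWeight X ε U V Z‖ ≤ ‖Z‖ :=
  norm_mulLeftRight_le (isContraction_mul_sigmaInv_mul_transpose X ε h.left_orthogonal)
    (isContraction_mul_sigmaInv_mul_transpose X ε h.right_orthogonal)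
    (isSymm_mul_sigmaInv_mul_transpose X ε V) Z

theorem transpose_mul_mul_apply_of_left (hε : 0 < ε) (h : IsSingularBases X ε U V) (i : Fin n₁)
    (j : Fin n₂) (hi : ε < sing X i) : (Uᵀ * X * V) i j = rectDiag n₁ n₂ (sing X) i j := by
  have hi₂ : (i : ℕ) < n₂ := not_le.1 fun h' => hε.not_gt (sing_of_right_le X h' ▸ hi)
  have horth : V.col ⟨i, hi₂⟩ ⬝ᵥ V.col j = (Vᵀ * V) ⟨i, hi₂⟩ j := rfl
  calc (Uᵀ * X * V) i j = (Xᵀ *ᵥ U.col i) ⬝ᵥ V.col j := by rw [Matrix.mulVec_transpose]; rfl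
    _ = rectDiag n₁ n₂ (sing X) i j := by
      rw [h.mul_left i ⟨i, hi₂⟩ rfl hi, smul_dotProduct, horth,
        transpose_mul_self_of_mem_orthogonalGroup h.right_orthogonal, Matrix.one_apply,
        rectDiag_apply]
      simp [Fin.ext_iff]

theorem transpose_mul_mul_apply_of_right (hε : 0 < ε) (h : IsSingularBases X ε U V) (i : Fin n₁)
    (j : Fin n₂) (hj : ε < sing X j) : (Uᵀ * X * V) i j = rectDiag n₁ n₂ (sing X) i j := by
  have hj₁ : (j : ℕ) < n₁ := not_le.1 fun h' => hε.not_gt (sing_of_left_le X h' ▸ hj)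
  have horth : U.col i ⬝ᵥ U.col ⟨j, hj₁⟩ = (Uᵀ * U) i ⟨j, hj₁⟩ := rfl
  calc (Uᵀ * X * V) i j = U.col i ⬝ᵥ (X *ᵥ V.col j) := by rw [Matrix.mul_assoc]; rfl
    _ = rectDiag n₁ n₂ (sing X) i j := by
      rw [h.mul_right ⟨j, hj₁⟩ j rfl hj, dotProduct_smul, horth,
        transpose_mul_self_of_mem_orthogonalGroup h.left_orthogonal, Matrix.one_apply,
        rectDiag_apply]
      by_cases hij : (i : ℕ) = j <;> simp [Fin.ext_iff, hij]

/-- Below the threshold `ε` all weights are `1`, so the unknown block of `Uᵀ * X * V` enters only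
through its Frobenius norm. -/
theorem inner_lowRankWeight_self (hε : 0 < ε) (h : IsSingularBases X ε U V) :
    ⟪X, lowRankWeight X ε U V X⟫_ℝ
      = ∑ i : Fin n₁, sqrtWeight ε (sing X i) ^ 2 * sing X i ^ 2 := by
  let w : ℕ → ℝ := fun i => sqrtWeight ε (sing X i)
  have hentry (i : Fin n₁) (j : Fin n₂) : w i * w j * (Uᵀ * X * V) i j ^ 2
      = (Uᵀ * X * V) i j ^ 2 + rectDiag n₁ n₂ (fun i => (w i ^ 2 - 1) * sing X i ^ 2) i j := by
    by_cases hij : ε < sing X i ∨ ε < sing X j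
    · rw [hij.elim (h.transpose_mul_mul_apply_of_left hε i j)
        (h.transpose_mul_mul_apply_of_right hε i j), rectDiag_apply, rectDiag_apply]
      split_ifs with hij'
      · rw [← hij']
        ring
      · ring
    · push Not at hij
      simp [w, rectDiag_apply, sqrtWeight_of_le hε hij.1, sqrtWeight_of_le hε hij.2]
  have hnorm : ‖Uᵀ * X * V‖ ^ 2 = ∑ i : Fin n₁, sing X i ^ 2 := by
    obtain ⟨A, B, hX⟩ := exists_isSVD X
    rw [norm_mul_mul_of_mem_orthogonalGroup (transpose_mem_orthogonalGroup h.left_orthogonal)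
      h.right_orthogonal, hX.norm_sq]
  calc ⟪X, lowRankWeight X ε U V X⟫_ℝ
      = ∑ i : Fin n₁, ∑ j : Fin n₂, w i * w j * (Uᵀ * X * V) i j ^ 2 :=
        inner_lowRankWeight X ε U V X
    _ = ∑ i : Fin n₁, sing X i ^ 2 + ∑ i : Fin n₁, (w i ^ 2 - 1) * sing X i ^ 2 := by
        rw [← hnorm, norm_sq_eq_sum, ← Finset.sum_add_distrib]
        refine Finset.sum_congr rfl fun i _ => ?_
        rw [← sum_rectDiag_row (s := fun i => (w i ^ 2 - 1) * sing X i ^ 2)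
          (fun i hi => by simp [sing_of_right_le X hi]) i, ← Finset.sum_add_distrib]
        exact Finset.sum_congr rfl fun j _ => hentry i j
    _ = ∑ i : Fin n₁, w i ^ 2 * sing X i ^ 2 := by
        rw [← Finset.sum_add_distrib]
        exact Finset.sum_congr rfl fun i _ => by ring

theorem isQuadraticMajorizer_Flr (hε : 0 < ε) (h : IsSingularBases X ε U V) :
    IsQuadraticMajorizer (Flr ε) (lowRankWeight X ε U V) X := fun Z => by
  have hleft := Flr_le_Flr_mul_left hε (isContraction_lowRankFactor X ε h.left_orthogonal)
    (det_lowRankFactor_ne_zero X ε h.left_orthogonal) Z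
  have hright := Flr_le_Flr_mul_right hε (isContraction_lowRankFactor X ε h.right_orthogonal)
    (det_lowRankFactor_ne_zero X ε h.right_orthogonal) (lowRankFactor X ε U * Z)
  have hnorm := Flr_le_half_norm_sq hε (lowRankFactor X ε U * Z * (lowRankFactor X ε V)ᵀ)
  have hX := (Flr_eq_sum_left ε X).trans
    (sum_fSmooth_eq hε fun j : Fin n₁ => sing_nonneg X j)
  rw [log_abs_det_lowRankFactor X ε h.left_orthogonal] at hleft
  rw [log_abs_det_lowRankFactor X ε h.right_orthogonal,
    ← sum_sing_eq_sum_sing (g := fun t => Real.log (sqrtWeight ε t)) X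
      (by simp [sqrtWeight])] at hright
  rw [norm_sq_lowRankFactor_mul_mul] at hnorm
  rw [h.inner_lowRankWeight_self hε]
  linarith

end IsSingularBases

/-! ### A tangent parabola below the low-rank objective -/

section DoublyStochastic

theorem inner_mul_mul_transpose_le {m m' n n' : Type*} [Fintype m] [Fintype m'] [Fintype n]
    [Fintype n'] {C : Matrix m n ℝ} {S : Matrix m' n' ℝ} (hC : ∀ i j, 0 ≤ C i j)
    (hS : ∀ k l, 0 ≤ S k l) (P : Matrix m m' ℝ) (Q : Matrix n n' ℝ) :
    ⟪C, P * S * Qᵀ⟫_ℝ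
      ≤ 1 / 2 * ∑ i, ∑ k, P i k ^ 2 * ((∑ j, C i j) * ∑ l, S k l)
        + 1 / 2 * ∑ j, ∑ l, Q j l ^ 2 * ((∑ i, C i j) * ∑ k, S k l) := by
  have hswap (F : m → m' → n → n' → ℝ) :
      ∑ i, ∑ k, ∑ j, ∑ l, F i k j l = ∑ j, ∑ l, ∑ i, ∑ k, F i k j l := by
    simpa only [Fintype.sum_prod_type] using Finset.sum_comm (s := (Finset.univ : Finset (m × m')))
      (t := (Finset.univ : Finset (n × n'))) (f := fun p q => F p.1 p.2 q.1 q.2)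
  calc ⟪C, P * S * Qᵀ⟫_ℝ = ∑ i, ∑ k, ∑ j, ∑ l, C i j * S k l * (P i k * Q j l) := by
        simp only [inner_eq_sum, Matrix.mul_apply, Matrix.transpose_apply, Finset.mul_sum,
          Finset.sum_mul]
        refine Finset.sum_congr rfl fun i _ =>
          ((Finset.sum_congr rfl fun j _ => Finset.sum_comm).trans Finset.sum_comm).trans ?_
        exact Finset.sum_congr rfl fun k _ => Finset.sum_congr rfl fun j _ =>
          Finset.sum_congr rfl fun l _ => by ring
    _ ≤ ∑ i, ∑ k, ∑ j, ∑ l, (1 / 2 * (P i k ^ 2 * (C i j * S k l))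
          + 1 / 2 * (Q j l ^ 2 * (C i j * S k l))) := by
        refine Finset.sum_le_sum fun i _ => Finset.sum_le_sum fun k _ =>
          Finset.sum_le_sum fun j _ => Finset.sum_le_sum fun l _ => ?_
        nlinarith [mul_nonneg (mul_nonneg (hC i j) (hS k l)) (sq_nonneg (P i k - Q j l))]
    _ = _ := by
        simp only [Finset.sum_mul_sum]
        simp only [Finset.sum_add_distrib, Finset.mul_sum]
        rw [hswap fun i k j l => 1 / 2 * (Q j l ^ 2 * (C i j * S k l))]

/-- The entries `P i k ^ 2` form a doubly stochastic matrix. -/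
theorem sum_sq_mul_le_of_mem_orthogonalGroup {n : Type*} [Fintype n] [DecidableEq n]
    {P : Matrix n n ℝ} (hP : P ∈ Matrix.orthogonalGroup n ℝ) {a b : n → ℝ} {w : n → n → ℝ}
    (h : ∀ i k, w i k ≤ a k - b i) :
    ∑ i, ∑ k, P i k ^ 2 * w i k ≤ ∑ k, a k - ∑ i, b i := by
  calc ∑ i, ∑ k, P i k ^ 2 * w i k ≤ ∑ i, ∑ k, P i k ^ 2 * (a k - b i) :=
        Finset.sum_le_sum fun i _ => Finset.sum_le_sum fun k _ =>
          mul_le_mul_of_nonneg_left (h i k) (sq_nonneg _)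
    _ = ∑ k, (∑ i, Pᵀ k i ^ 2) * a k - ∑ i, (∑ k, P i k ^ 2) * b i := by
        simp only [mul_sub, Finset.sum_sub_distrib, Finset.sum_mul]
        rw [Finset.sum_comm]
        rfl
    _ = _ := by
        simp only [sum_sq_row_of_mem_orthogonalGroup hP,
          sum_sq_row_of_mem_orthogonalGroup (transpose_mem_orthogonalGroup hP), one_mul]

end DoublyStochastic

namespace IsSVD

variable {n₁ n₂ : ℕ} {X Z : Matrix (Fin n₁) (Fin n₂) ℝ} {U A : Matrix (Fin n₁) (Fin n₁) ℝ}
  {V B : Matrix (Fin n₂) (Fin n₂) ℝ} {s t : ℕ → ℝ}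

/-- A form of von Neumann's trace inequality, for a pair `g`, `b` as in Young's inequality. -/
theorem inner_mul_rectDiag_mul_transpose_le (h : IsSVD X U V s) (h' : IsSVD Z A B t)
    {c g b : ℝ → ℝ} (hc : ∀ x, 0 ≤ x → 0 ≤ c x) (hc0 : c 0 = 0) (hg0 : g 0 = 0) (hb0 : b 0 = 0)
    (hle : ∀ x y, 0 ≤ x → 0 ≤ y → c x * y ≤ g y - b x) :
    ⟪U * rectDiag n₁ n₂ (fun i => c (s i)) * Vᵀ, Z⟫_ℝ
      ≤ ∑ i : Fin n₁, g (t i) - ∑ i : Fin n₁, b (s i) := by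
  have hrot : ⟪U * rectDiag n₁ n₂ (fun i => c (s i)) * Vᵀ, Z⟫_ℝ
      = ⟪rectDiag n₁ n₂ (fun i => c (s i)), Uᵀ * A * rectDiag n₁ n₂ t * (Vᵀ * B)ᵀ⟫_ℝ := by
    conv_lhs => rw [h'.eq]
    rw [inner_mul_right_eq, inner_mul_left_eq, Matrix.transpose_mul, Matrix.transpose_transpose]
    simp only [Matrix.mul_assoc]
  have hP := mul_mem (transpose_mem_orthogonalGroup h.left_orthogonal) h'.left_orthogonal
  have hQ := mul_mem (transpose_mem_orthogonalGroup h.right_orthogonal) h'.right_orthogonal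
  have hpair (i k : ℕ) : c (s i) * t k ≤ g (t k) - b (s i) :=
    hle _ _ (h.nonneg i) (h'.nonneg k)
  have hC₁ (i : ℕ) (hi : n₁ ≤ i) : c (s i) = 0 := by rw [h.left_zero i hi, hc0]
  have hC₂ (i : ℕ) (hi : n₂ ≤ i) : c (s i) = 0 := by rw [h.right_zero i hi, hc0]
  have hbound := inner_mul_mul_transpose_le
    (C := rectDiag n₁ n₂ fun i => c (s i)) (S := rectDiag n₁ n₂ t)
    (fun i j => by rw [rectDiag_apply]; split_ifs <;> simp [hc _ (h.nonneg _)])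
    (fun i j => by rw [rectDiag_apply]; split_ifs <;> simp [h'.nonneg]) (Uᵀ * A) (Vᵀ * B)
  simp only [sum_rectDiag_row hC₂, sum_rectDiag_row h'.right_zero, sum_rectDiag_col hC₁,
    sum_rectDiag_col h'.left_zero] at hbound
  have hrow := sum_sq_mul_le_of_mem_orthogonalGroup hP fun i k : Fin n₁ => hpair i k
  have hcol := sum_sq_mul_le_of_mem_orthogonalGroup hQ fun j l : Fin n₂ => hpair j l
  have hg : ∑ i : Fin n₁, g (t i) = ∑ i : Fin n₂, g (t i) :=
    sum_fin_eq_sum_fin (s := fun i => g (t i)) (fun i hi => by rw [h'.left_zero i hi, hg0])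
      fun i hi => by rw [h'.right_zero i hi, hg0]
  have hb : ∑ i : Fin n₁, b (s i) = ∑ i : Fin n₂, b (s i) :=
    sum_fin_eq_sum_fin (s := fun i => b (s i)) (fun i hi => by rw [h.left_zero i hi, hb0])
      fun i hi => by rw [h.right_zero i hi, hb0]
  rw [hrot]
  linarith

theorem mulVec_col (h : IsSVD X U V s) {i : Fin n₁} {j : Fin n₂} (hij : (i : ℕ) = j) :
    X *ᵥ V.col j = s i • U.col i := by
  ext k
  have hcol : (X *ᵥ V.col j) k = (X * V) k j := rfl
  rw [hcol, h.mul_right_eq, Matrix.mul_apply, Finset.sum_eq_single i]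
  · simp [rectDiag_apply, hij, mul_comm]
  · intro l _ hl
    have hlj : (l : ℕ) ≠ j := fun hlj => hl (Fin.ext (hlj.trans hij.symm))
    simp [rectDiag_apply, hlj]
  · simp

theorem isSingularBases (h : IsSVD X U V (sing X)) (ε : ℝ) : IsSingularBases X ε U V where
  left_orthogonal := h.left_orthogonal
  right_orthogonal := h.right_orthogonal
  mul_right _ _ hij _ := h.mulVec_col hij
  mul_left _ _ hij _ := by rw [h.transpose.mulVec_col hij.symm, hij]

theorem lowRankWeight_self (h : IsSVD X U V (sing X)) (ε : ℝ) :
    lowRankWeight X ε U V X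
      = U * rectDiag n₁ n₂ (fun i => sqrtWeight ε (sing X i) ^ 2 * sing X i) * Vᵀ := by
  have hdiag : sigmaInv X ε n₁ * rectDiag n₁ n₂ (sing X) * sigmaInv X ε n₂
      = rectDiag n₁ n₂ (fun i => sqrtWeight ε (sing X i) ^ 2 * sing X i) := by
    ext i j
    rw [sigmaInv, sigmaInv, Matrix.mul_diagonal, Matrix.diagonal_mul, rectDiag_apply,
      rectDiag_apply, sqrtWeight]
    split_ifs with hij
    · rw [hij]
      ring
    · ring
  rw [← hdiag, ← h.transpose_mul_mul_eq]
  simp only [lowRankWeight, mulLeftRight_apply, Matrix.mul_assoc]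

theorem le_Flr {τ : ℝ} (hτ : 0 < τ) (h : IsSVD X U V (sing X)) (Z : Matrix (Fin n₁) (Fin n₂) ℝ) :
    Flr τ X + ⟪lowRankWeight X τ U V X, Z - X⟫_ℝ - ‖Z - X‖ ^ 2 ≤ Flr τ Z := by
  obtain ⟨A, B, h'⟩ := exists_isSVD Z
  have hle := h.inner_mul_rectDiag_mul_transpose_le h'
    (c := fun x => sqrtWeight τ x ^ 2 * x + 2 * x) (g := fun y => fSmooth τ y + y ^ 2)
    (b := fun x => fSmooth τ x - sqrtWeight τ x ^ 2 * x ^ 2 - x ^ 2)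
    (fun x hx => by positivity) (by simp) (by simp [fSmooth_apply_zero])
    (by simp [fSmooth_apply_zero])
    (fun x y hx hy => by linarith [le_fSmooth hτ hx hy])
  have hsum : U * rectDiag n₁ n₂
        (fun i => sqrtWeight τ (sing X i) ^ 2 * sing X i + 2 * sing X i) * Vᵀ
      = lowRankWeight X τ U V X + (2 : ℝ) • X := by
    have hadd : rectDiag n₁ n₂ (fun i => sqrtWeight τ (sing X i) ^ 2 * sing X i + 2 * sing X i)
        = rectDiag n₁ n₂ (fun i => sqrtWeight τ (sing X i) ^ 2 * sing X i)
          + (2 : ℝ) • rectDiag n₁ n₂ (sing X) := by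
      ext i j
      by_cases hij : (i : ℕ) = j <;> simp [rectDiag_apply, hij]
    rw [hadd, Matrix.mul_add, Matrix.add_mul, Matrix.mul_smul, Matrix.smul_mul, ← h.eq,
      h.lowRankWeight_self]
  rw [hsum, inner_add_left, real_inner_smul_left] at hle
  simp only [Finset.sum_add_distrib, Finset.sum_sub_distrib, ← Flr_eq_sum_left, ← h.norm_sq,
    ← h'.norm_sq, ← (h.isSingularBases τ).inner_lowRankWeight_self hτ] at hle
  rw [norm_sub_sq_real, inner_sub_right, real_inner_comm X Z,
    real_inner_comm X (lowRankWeight X τ U V X)]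
  linarith

end IsSVD

/-! ### The row-sparsity objective -/

section Rows

variable {n₁ n₂ : ℕ} {δ : ℝ}

theorem le_fSmooth_norm {E : Type*} [NormedAddCommGroup E] [InnerProductSpace ℝ E] {τ : ℝ}
    (hτ : 0 < τ) (v w : E) :
    fSmooth τ ‖v‖ + sqrtWeight τ ‖v‖ ^ 2 * ⟪v, w - v⟫_ℝ - ‖w - v‖ ^ 2 ≤ fSmooth τ ‖w‖ := by
  have hle := le_fSmooth hτ (norm_nonneg v) (norm_nonneg w)
  have hinner : ⟪v, w - v⟫_ℝ = ⟪w, v⟫_ℝ - ‖v‖ ^ 2 := by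
    rw [inner_sub_right, real_inner_comm, real_inner_self_eq_norm_sq]
  have hcs := mul_le_mul_of_nonneg_left (real_inner_le_norm w v)
    (by positivity : 0 ≤ sqrtWeight τ ‖v‖ ^ 2 + 2)
  rw [hinner, norm_sub_sq_real]
  linarith

theorem rowNorm_nonneg (X : Matrix (Fin n₁) (Fin n₂) ℝ) (i : Fin n₁) : 0 ≤ rowNorm X i :=
  norm_nonneg _

theorem inner_eq_sum_inner_row (A B : Matrix (Fin n₁) (Fin n₂) ℝ) :
    ⟪A, B⟫_ℝ = ∑ i, ⟪WithLp.toLp 2 (A i), WithLp.toLp 2 (B i)⟫_ℝ := by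
  rw [inner_eq_sum]
  refine Finset.sum_congr rfl fun i _ => ?_
  rw [PiLp.inner_apply]
  exact Finset.sum_congr rfl fun j _ => mul_comm _ _

theorem norm_sq_eq_sum_rowNorm_sq (X : Matrix (Fin n₁) (Fin n₂) ℝ) :
    ‖X‖ ^ 2 = ∑ i, rowNorm X i ^ 2 := by
  rw [← real_inner_self_eq_norm_sq, inner_eq_sum_inner_row]
  exact Finset.sum_congr rfl fun i _ => real_inner_self_eq_norm_sq _

/-- `Z ↦ Wsp X δ * Z` as a linear map. -/
noncomputable def rowWeight (X : Matrix (Fin n₁) (Fin n₂) ℝ) (δ : ℝ) :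
    Matrix (Fin n₁) (Fin n₂) ℝ →ₗ[ℝ] Matrix (Fin n₁) (Fin n₂) ℝ :=
  mulLeftRight (Wsp X δ) 1

theorem rowWeight_apply (X : Matrix (Fin n₁) (Fin n₂) ℝ) (δ : ℝ)
    (Z : Matrix (Fin n₁) (Fin n₂) ℝ) : rowWeight X δ Z = Wsp X δ * Z := by
  rw [rowWeight, mulLeftRight_apply, Matrix.mul_one]

theorem isSymmetric_rowWeight (X : Matrix (Fin n₁) (Fin n₂) ℝ) (δ : ℝ) :
    (rowWeight X δ).IsSymmetric :=
  isSymmetric_mulLeftRight (Matrix.isSymm_diagonal _) Matrix.isSymm_one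

theorem norm_rowWeight_le (X : Matrix (Fin n₁) (Fin n₂) ℝ) (δ : ℝ)
    (Z : Matrix (Fin n₁) (Fin n₂) ℝ) : ‖rowWeight X δ Z‖ ≤ ‖Z‖ :=
  norm_mulLeftRight_le (.diagonal (fun _ => by positivity)
    fun _ => inv_le_one_of_one_le₀ (le_max_right _ _))
    (.of_mem_orthogonalGroup (one_mem _)) Matrix.isSymm_one Z

theorem inner_rowWeight (hδ : 0 < δ) (X A B : Matrix (Fin n₁) (Fin n₂) ℝ) :
    ⟪A, rowWeight X δ B⟫_ℝ = ∑ i, sqrtWeight δ (rowNorm X i) ^ 2 *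
      ⟪WithLp.toLp 2 (A i), WithLp.toLp 2 (B i)⟫_ℝ := by
  rw [inner_eq_sum_inner_row]
  refine Finset.sum_congr rfl fun i _ => ?_
  have hrow : rowWeight X δ B i = sqrtWeight δ (rowNorm X i) ^ 2 • B i := by
    ext j
    rw [rowWeight_apply, Wsp, Matrix.diagonal_mul, inv_max_sq_div_sq hδ (rowNorm_nonneg X i)]
    rfl
  rw [hrow, WithLp.toLp_smul, inner_smul_right]

theorem isQuadraticMajorizer_Fsp (hδ : 0 < δ) (X : Matrix (Fin n₁) (Fin n₂) ℝ) :
    IsQuadraticMajorizer (Fsp δ) (rowWeight X δ) X := fun Z => by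
  simp only [Fsp, inner_rowWeight hδ, Finset.mul_sum, ← Finset.sum_add_distrib,
    ← Finset.sum_sub_distrib, real_inner_self_eq_norm_sq]
  refine Finset.sum_le_sum fun i _ => ?_
  have hw := sqrtWeight_pos δ (rowNorm X i)
  have hle := fSmooth_le hδ (rowNorm_nonneg Z i) (pow_pos hw 2)
    (pow_le_one₀ hw.le (sqrtWeight_le_one _ _))
  have heq := fSmooth_eq_sqrtWeight hδ (rowNorm_nonneg X i)
  rw [Real.log_pow] at hle
  push_cast at hle
  simp only [rowNorm] at hle heq ⊢
  linarith

theorem le_Fsp (hδ : 0 < δ) (X Z : Matrix (Fin n₁) (Fin n₂) ℝ) :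
    Fsp δ X + ⟪rowWeight X δ X, Z - X⟫_ℝ - ‖Z - X‖ ^ 2 ≤ Fsp δ Z := by
  have hsymm : ⟪rowWeight X δ X, Z - X⟫_ℝ = ⟪X, rowWeight X δ (Z - X)⟫_ℝ :=
    isSymmetric_rowWeight X δ X (Z - X)
  rw [hsymm, inner_rowWeight hδ, norm_sq_eq_sum_rowNorm_sq]
  simp only [Fsp, ← Finset.sum_add_distrib, ← Finset.sum_sub_distrib]
  exact Finset.sum_le_sum fun i _ => le_fSmooth_norm hδ (WithLp.toLp 2 (X i)) (WithLp.toLp 2 (Z i))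

theorem rowNormSorted_nonneg (X : Matrix (Fin n₁) (Fin n₂) ℝ) (s : ℕ) :
    0 ≤ rowNormSorted X s := by
  rw [rowNormSorted]
  rcases lt_or_ge s ((Finset.univ.val.map (rowNorm X)).sort (· ≥ ·)).length with hs | hs
  · rw [List.getD_eq_getElem _ _ hs]
    obtain ⟨i, -, hi⟩ := Multiset.mem_map.1 ((Multiset.mem_sort _).1 (List.getElem_mem hs))
    exact (rowNorm_nonneg X i).trans_eq hi
  · rw [List.getD_eq_default _ _ hs]

end Rows

/-! ### The combined objective -/

section Objective

variable {n₁ n₂ : ℕ}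

theorem frobInner_matGrad (G : Matrix (Fin n₁) (Fin n₂) ℝ → ℝ)
    (X D : Matrix (Fin n₁) (Fin n₂) ℝ) : frobInner (matGrad G X) D = fderiv ℝ G X D := by
  conv_rhs => rw [Matrix.matrix_eq_sum_single D]
  simp only [map_sum, frobInner, matGrad, Matrix.of_apply]
  refine Finset.sum_congr rfl fun i _ => Finset.sum_congr rfl fun j _ => ?_
  have hsingle : Matrix.single i j (D i j) = D i j • Matrix.single i j (1 : ℝ) := by
    rw [Matrix.smul_single, smul_eq_mul, mul_one]
  rw [hsingle, map_smul, smul_eq_mul, mul_comm]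

theorem IsQuadraticMajorizer.apply_le_matGrad {G : Matrix (Fin n₁) (Fin n₂) ℝ → ℝ}
    {T : Matrix (Fin n₁) (Fin n₂) ℝ →ₗ[ℝ] Matrix (Fin n₁) (Fin n₂) ℝ}
    {X : Matrix (Fin n₁) (Fin n₂) ℝ} (hG : IsQuadraticMajorizer G T X) (hT : T.IsSymmetric)
    (hd : DifferentiableAt ℝ G X) (Z : Matrix (Fin n₁) (Fin n₂) ℝ) :
    G Z ≤ G X + frobInner (matGrad G X) (Z - X) + 1 / 2 * frobInner (Z - X) (T (Z - X)) := by
  rw [frobInner_matGrad]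
  exact (hG.apply_le hT Z).trans_eq (by rw [← hG.fderiv_apply hT hd]; rfl)

theorem differentiableAt_Flr {ε : ℝ} (hε : 0 < ε) (X : Matrix (Fin n₁) (Fin n₂) ℝ) :
    DifferentiableAt ℝ (Flr ε) X := by
  obtain ⟨U, V, hX⟩ := exists_isSVD X
  have hbases := hX.isSingularBases ε
  exact (hbases.isQuadraticMajorizer_Flr hε).differentiableAt
    (isSymmetric_lowRankWeight X ε U V) (C := 1) (c := 1)
    (fun Z => by rw [one_mul]; exact hbases.norm_lowRankWeight_le Z)
    fun Z => by rw [one_mul]; exact hX.le_Flr hε Z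

theorem differentiableAt_Fsp {δ : ℝ} (hδ : 0 < δ) (X : Matrix (Fin n₁) (Fin n₂) ℝ) :
    DifferentiableAt ℝ (Fsp δ) X :=
  (isQuadraticMajorizer_Fsp hδ X).differentiableAt (isSymmetric_rowWeight X δ) (C := 1) (c := 1)
    (fun Z => by rw [one_mul]; exact norm_rowWeight_le X δ Z)
    fun Z => by rw [one_mul]; exact le_Fsp hδ X Z

theorem differentiableAt_F {ε δ : ℝ} (hε : 0 < ε) (hδ : 0 < δ)
    (X : Matrix (Fin n₁) (Fin n₂) ℝ) : DifferentiableAt ℝ (F ε δ) X :=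
  (differentiableAt_Flr hε X).add (differentiableAt_Fsp hδ X)

theorem Flr_nonneg {ε : ℝ} (hε : 0 ≤ ε) (X : Matrix (Fin n₁) (Fin n₂) ℝ) : 0 ≤ Flr ε X :=
  Finset.sum_nonneg fun i _ => fSmooth_nonneg hε (sing_nonneg X i)

theorem fSmooth_rowNorm_le_F {ε δ : ℝ} (hε : 0 ≤ ε) (hδ : 0 ≤ δ)
    (X : Matrix (Fin n₁) (Fin n₂) ℝ) (i : Fin n₁) : fSmooth δ (rowNorm X i) ≤ F ε δ X :=
  (Finset.single_le_sum (f := fun i => fSmooth δ (rowNorm X i))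
    (fun i _ => fSmooth_nonneg hδ (rowNorm_nonneg X i)) (Finset.mem_univ i)).trans
    (le_add_of_nonneg_left (Flr_nonneg hε X))

theorem F_nonneg {ε δ : ℝ} (hε : 0 ≤ ε) (hδ : 0 ≤ δ) (X : Matrix (Fin n₁) (Fin n₂) ℝ) :
    0 ≤ F ε δ X :=
  add_nonneg (Flr_nonneg hε X)
    (Finset.sum_nonneg fun i _ => fSmooth_nonneg hδ (rowNorm_nonneg X i))

theorem F_mono {ε ε' δ δ' : ℝ} (hε : 0 ≤ ε) (hεε' : ε ≤ ε') (hδ : 0 ≤ δ) (hδδ' : δ ≤ δ')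
    (X : Matrix (Fin n₁) (Fin n₂) ℝ) : F ε δ X ≤ F ε' δ' X :=
  add_le_add
    (Finset.sum_le_sum fun i _ => fSmooth_mono_left hε hεε' (sing_nonneg X i))
    (Finset.sum_le_sum fun i _ => fSmooth_mono_left hδ hδδ' (rowNorm_nonneg X i))

end Objective

section weight

variable {n₁ n₂ : ℕ} (X : Matrix (Fin n₁) (Fin n₂) ℝ) (ε δ : ℝ)
  (U : Matrix (Fin n₁) (Fin n₁) ℝ) (V : Matrix (Fin n₂) (Fin n₂) ℝ)

/-- `W X ε δ U V` as a linear map. -/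
noncomputable def weight : Matrix (Fin n₁) (Fin n₂) ℝ →ₗ[ℝ] Matrix (Fin n₁) (Fin n₂) ℝ :=
  lowRankWeight X ε U V + rowWeight X δ

theorem weight_apply (Z : Matrix (Fin n₁) (Fin n₂) ℝ) :
    weight X ε δ U V Z = W X ε δ U V Z := by
  rw [weight, LinearMap.add_apply, lowRankWeight_apply, rowWeight_apply, W]

theorem isSymmetric_weight : (weight X ε δ U V).IsSymmetric :=
  (isSymmetric_lowRankWeight X ε U V).add (isSymmetric_rowWeight X δ)

variable {X ε δ}

/-- Every row of `X` satisfies `fSmooth δ (rowNorm X i) ≤ F ε δ X`, which bounds its norm. -/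
theorem exp_neg_mul_norm_sq_le_inner_weight (hε : 0 ≤ ε) (hδ : 0 < δ)
    (Z : Matrix (Fin n₁) (Fin n₂) ℝ) :
    Real.exp (-(2 * F ε δ X / δ ^ 2)) * ‖Z‖ ^ 2 ≤ ⟪Z, weight X ε δ U V Z⟫_ℝ := by
  have hlowRank : 0 ≤ ⟪Z, lowRankWeight X ε U V Z⟫_ℝ := by
    rw [inner_lowRankWeight]
    exact Finset.sum_nonneg fun i _ => Finset.sum_nonneg fun j _ => mul_nonneg
      (mul_nonneg (sqrtWeight_pos _ _).le (sqrtWeight_pos _ _).le) (sq_nonneg _)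
  have hfactor (i : Fin n₁) :
      Real.exp (-(2 * F ε δ X / δ ^ 2)) ≤ sqrtWeight δ (rowNorm X i) ^ 2 := by
    rw [Real.exp_neg, ← inv_max_sq_div_sq hδ (rowNorm_nonneg X i)]
    refine inv_anti₀ (lt_of_lt_of_le one_pos (le_max_right _ _)) ?_
    refine (max_sq_div_sq_le_exp hδ (rowNorm_nonneg X i)).trans ?_
    gcongr
    exact fSmooth_rowNorm_le_F hε hδ.le X i
  rw [weight, LinearMap.add_apply, inner_add_right, inner_rowWeight hδ, norm_sq_eq_sum_rowNorm_sq,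
    Finset.mul_sum]
  refine le_add_of_nonneg_of_le hlowRank (Finset.sum_le_sum fun i _ => ?_)
  rw [real_inner_self_eq_norm_sq]
  exact mul_le_mul_of_nonneg_right (hfactor i) (sq_nonneg _)

end weight

namespace IsSingularBases

variable {n₁ n₂ : ℕ} {X : Matrix (Fin n₁) (Fin n₂) ℝ} {ε δ : ℝ}
  {U : Matrix (Fin n₁) (Fin n₁) ℝ} {V : Matrix (Fin n₂) (Fin n₂) ℝ}

theorem norm_weight_le (h : IsSingularBases X ε U V) (δ : ℝ) (Z : Matrix (Fin n₁) (Fin n₂) ℝ) :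
    ‖weight X ε δ U V Z‖ ≤ 2 * ‖Z‖ := by
  rw [two_mul]
  exact norm_add_le_of_le (h.norm_lowRankWeight_le Z) (norm_rowWeight_le X δ Z)

theorem isQuadraticMajorizer_F (hε : 0 < ε) (hδ : 0 < δ) (h : IsSingularBases X ε U V) :
    IsQuadraticMajorizer (F ε δ) (weight X ε δ U V) X :=
  (h.isQuadraticMajorizer_Flr hε).add (isQuadraticMajorizer_Fsp hδ X)

theorem F_le_Q (hε : 0 < ε) (hδ : 0 < δ) (h : IsSingularBases X ε U V)
    (Z : Matrix (Fin n₁) (Fin n₂) ℝ) : F ε δ Z ≤ Qlr X ε U V Z + Qsp X δ Z := by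
  have hlr := (h.isQuadraticMajorizer_Flr hε).apply_le_matGrad
    (isSymmetric_lowRankWeight X ε U V) (differentiableAt_Flr hε X) Z
  have hsp := (isQuadraticMajorizer_Fsp hδ X).apply_le_matGrad
    (isSymmetric_rowWeight X δ) (differentiableAt_Fsp hδ X) Z
  rw [lowRankWeight_apply] at hlr
  rw [rowWeight_apply] at hsp
  exact add_le_add hlr hsp

end IsSingularBases

theorem tendsto_F {n₁ n₂ : ℕ} {ι : Type*} {l : Filter ι} {ε δ : ι → ℝ} {ε₀ δ₀ : ℝ}
    {Y : ι → Matrix (Fin n₁) (Fin n₂) ℝ} {Y₀ : Matrix (Fin n₁) (Fin n₂) ℝ} (hε₀ : 0 < ε₀)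
    (hδ₀ : 0 < δ₀) (hε : Tendsto ε l (𝓝 ε₀)) (hδ : Tendsto δ l (𝓝 δ₀))
    (hY : Tendsto Y l (𝓝 Y₀)) :
    Tendsto (fun k => F (ε k) (δ k) (Y k)) l (𝓝 (F ε₀ δ₀ Y₀)) := by
  have hY₀ : Tendsto (fun k => F (ε k) (δ k) Y₀) l (𝓝 (F ε₀ δ₀ Y₀)) :=
    (tendsto_finsetSum _ fun i _ => tendsto_fSmooth hε₀ (sing_nonneg Y₀ i) hε).add
      (tendsto_finsetSum _ fun i _ => tendsto_fSmooth hδ₀ (rowNorm_nonneg Y₀ i) hδ)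
  refine tendsto_apply_of_exists_isQuadraticMajorizer (C := 2) hY hY₀ ?_
  filter_upwards [hε.eventually (eventually_gt_nhds hε₀), hδ.eventually (eventually_gt_nhds hδ₀)]
    with k hεk hδk Z
  obtain ⟨U, V, hZ⟩ := exists_isSVD Z
  have hbases := hZ.isSingularBases (ε k)
  exact ⟨weight Z (ε k) (δ k) U V, isSymmetric_weight Z (ε k) (δ k) U V,
    hbases.norm_weight_le (δ k), hbases.isQuadraticMajorizer_F hεk hδk⟩

/-! ### The iteration -/

theorem le_of_tendsto_of_succ_le {u : ℕ → ℝ} {a : ℝ} {n k : ℕ}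
    (hu : ∀ k, n ≤ k → u (k + 1) ≤ u k) (hlim : Tendsto u atTop (𝓝 a)) (hk : n ≤ k) : a ≤ u k :=
  le_of_tendsto hlim <| (eventually_ge_atTop k).mono fun _ hl =>
    antitoneOn_nat_Ici_of_succ_le hu hk (hk.trans hl) hl

namespace IsIRLSSequence

variable {n₁ n₂ m : ℕ} {A : Matrix (Fin n₁) (Fin n₂) ℝ →ₗ[ℝ] (Fin m → ℝ)} {y : Fin m → ℝ}
  {r s : ℕ} {X : ℕ → Matrix (Fin n₁) (Fin n₂) ℝ} {ε δ : ℕ → ℝ}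
  {U : ℕ → Matrix (Fin n₁) (Fin n₁) ℝ} {V : ℕ → Matrix (Fin n₂) (Fin n₂) ℝ}

theorem eps_nonneg (h : IsIRLSSequence A y r s X ε δ U V) {k : ℕ} (hk : 1 ≤ k) : 0 ≤ ε k := by
  induction k, hk using Nat.le_induction with
  | base => exact (sing_nonneg _ _).trans_eq h.eps_one.symm
  | succ k hk ih => exact (le_min ih (sing_nonneg _ _)).trans_eq (h.eps_succ k hk).symm

theorem delta_nonneg (h : IsIRLSSequence A y r s X ε δ U V) {k : ℕ} (hk : 1 ≤ k) : 0 ≤ δ k := by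
  induction k, hk using Nat.le_induction with
  | base => exact (rowNormSorted_nonneg _ _).trans_eq h.delta_one.symm
  | succ k hk ih => exact (le_min ih (rowNormSorted_nonneg _ _)).trans_eq (h.delta_succ k hk).symm

theorem eps_succ_le (h : IsIRLSSequence A y r s X ε δ U V) {k : ℕ} (hk : 1 ≤ k) :
    ε (k + 1) ≤ ε k :=
  (h.eps_succ k hk).trans_le (min_le_left _ _)

theorem delta_succ_le (h : IsIRLSSequence A y r s X ε δ U V) {k : ℕ} (hk : 1 ≤ k) :
    δ (k + 1) ≤ δ k :=
  (h.delta_succ k hk).trans_le (min_le_left _ _)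

theorem map_eq (h : IsIRLSSequence A y r s X ε δ U V) {k : ℕ} (hk : 1 ≤ k) (hε : 0 < ε k)
    (hδ : 0 < δ k) : A (X k) = y := by
  cases k, hk using Nat.le_induction with
  | base => exact h.wls_one.1
  | succ k hk =>
    exact (h.wls_succ k hk (hε.trans_le (h.eps_succ_le hk)) (hδ.trans_le (h.delta_succ_le hk))).1

theorem inner_weight_succ_eq_zero (h : IsIRLSSequence A y r s X ε δ U V) {k : ℕ} (hk : 1 ≤ k)
    (hε : 0 < ε k) (hδ : 0 < δ k) {Ξ : Matrix (Fin n₁) (Fin n₂) ℝ} (hΞ : A Ξ = 0) :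
    ⟪weight (X k) (ε k) (δ k) (U k) (V k) (X (k + 1)), Ξ⟫_ℝ = 0 := by
  obtain ⟨hfeasible, hmin⟩ := h.wls_succ k hk hε hδ
  refine inner_map_eq_zero_of_forall_le (isSymmetric_weight _ _ _ _ _) (fun Z hZ => ?_) hΞ
  rw [weight_apply, weight_apply]
  exact hmin Z (hZ.trans hfeasible)

theorem F_succ_add_le (h : IsIRLSSequence A y r s X ε δ U V) {k : ℕ} (hk : 1 ≤ k)
    (hε : 0 < ε k) (hδ : 0 < δ k) :
    F (ε (k + 1)) (δ (k + 1)) (X (k + 1)) + 1 / 2 *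
      ⟪X k - X (k + 1), weight (X k) (ε k) (δ k) (U k) (V k) (X k - X (k + 1))⟫_ℝ
      ≤ F (ε k) (δ k) (X k) := by
  have hker : A (X k - X (k + 1)) = 0 := by
    rw [map_sub, h.map_eq hk hε hδ, (h.wls_succ k hk hε hδ).1, sub_self]
  have hmono := F_mono (h.eps_nonneg (Nat.le_add_left 1 k)) (h.eps_succ_le hk)
    (h.delta_nonneg (Nat.le_add_left 1 k)) (h.delta_succ_le hk) (X (k + 1))
  have hdescent := ((h.bases k hk hε hδ).isQuadraticMajorizer_F hε hδ).apply_add_half_inner_le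
    (isSymmetric_weight _ _ _ _ _) (h.inner_weight_succ_eq_zero hk hε hδ hker)
  linarith

theorem F_succ_add_mul_norm_sq_le (h : IsIRLSSequence A y r s X ε δ U V) {k : ℕ} (hk : 1 ≤ k)
    (hε : 0 < ε k) (hδ : 0 < δ k) :
    F (ε (k + 1)) (δ (k + 1)) (X (k + 1)) + 1 / 2 *
      (Real.exp (-(2 * F (ε k) (δ k) (X k) / δ k ^ 2)) * ‖X k - X (k + 1)‖ ^ 2)
      ≤ F (ε k) (δ k) (X k) := by
  refine le_trans ?_ (h.F_succ_add_le hk hε hδ)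
  gcongr
  exact exp_neg_mul_norm_sq_le_inner_weight (U k) (V k) hε.le hδ _

theorem F_succ_le (h : IsIRLSSequence A y r s X ε δ U V) {k : ℕ} (hk : 1 ≤ k)
    (hε : 0 < ε k) (hδ : 0 < δ k) :
    F (ε (k + 1)) (δ (k + 1)) (X (k + 1)) ≤ F (ε k) (δ k) (X k) :=
  (le_add_of_nonneg_right (by positivity)).trans (h.F_succ_add_mul_norm_sq_le hk hε hδ)

theorem F_add_le (h : IsIRLSSequence A y r s X ε δ U V) {k : ℕ} (hk : 1 ≤ k)
    (hε : 0 < ε k) (hδ : 0 < δ k) {Ξ : Matrix (Fin n₁) (Fin n₂) ℝ} (hΞ : A Ξ = 0) :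
    F (ε k) (δ k) (X k + Ξ) ≤ F (ε k) (δ k) (X k) + 2 * ‖X k - X (k + 1)‖ * ‖Ξ‖ + ‖Ξ‖ ^ 2 := by
  have hbases := h.bases k hk hε hδ
  have hle := (hbases.isQuadraticMajorizer_F hε hδ).apply_add_le_of_inner_eq_zero
    (isSymmetric_weight _ _ _ _ _) (hbases.norm_weight_le (δ k))
    (h.inner_weight_succ_eq_zero hk hε hδ hΞ)
  rwa [div_self two_ne_zero, one_mul] at hle

section Limit

variable {εbar δbar : ℝ}

theorem le_eps (h : IsIRLSSequence A y r s X ε δ U V) (hlim : Tendsto ε atTop (𝓝 εbar)) {k : ℕ}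
    (hk : 1 ≤ k) : εbar ≤ ε k :=
  le_of_tendsto_of_succ_le (fun _ => h.eps_succ_le) hlim hk

theorem le_delta (h : IsIRLSSequence A y r s X ε δ U V) (hlim : Tendsto δ atTop (𝓝 δbar)) {k : ℕ}
    (hk : 1 ≤ k) : δbar ≤ δ k :=
  le_of_tendsto_of_succ_le (fun _ => h.delta_succ_le) hlim hk

theorem antitone_F (h : IsIRLSSequence A y r s X ε δ U V) (hε : ∀ k, 1 ≤ k → 0 < ε k)
    (hδ : ∀ k, 1 ≤ k → 0 < δ k) :
    Antitone fun k => F (ε (k + 1)) (δ (k + 1)) (X (k + 1)) :=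
  antitone_nat_of_succ_le fun k =>
    h.F_succ_le (Nat.le_add_left 1 k) (hε _ (Nat.le_add_left 1 k)) (hδ _ (Nat.le_add_left 1 k))

theorem norm_sub_sq_le (h : IsIRLSSequence A y r s X ε δ U V) (hε : ∀ k, 1 ≤ k → 0 < ε k)
    (hδbar : 0 < δbar) (hδ : ∀ k, 1 ≤ k → δbar ≤ δ k) (k : ℕ) :
    ‖X (k + 1) - X (k + 2)‖ ^ 2 ≤ 2 * Real.exp (2 * F (ε 1) (δ 1) (X 1) / δbar ^ 2) *
      (F (ε (k + 1)) (δ (k + 1)) (X (k + 1)) - F (ε (k + 2)) (δ (k + 2)) (X (k + 2))) := by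
  have hk : 1 ≤ k + 1 := Nat.le_add_left 1 k
  have hδ' : ∀ k, 1 ≤ k → 0 < δ k := fun k hk => hδbar.trans_le (hδ k hk)
  have hdescent := h.F_succ_add_mul_norm_sq_le hk (hε _ hk) (hδ' _ hk)
  have hbound : 2 * F (ε (k + 1)) (δ (k + 1)) (X (k + 1)) / δ (k + 1) ^ 2
      ≤ 2 * F (ε 1) (δ 1) (X 1) / δbar ^ 2 := by
    have hF₁ := F_nonneg (hε 1 le_rfl).le (hδ' 1 le_rfl).le (X 1)
    have hF : F (ε (k + 1)) (δ (k + 1)) (X (k + 1)) ≤ F (ε 1) (δ 1) (X 1) :=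
      h.antitone_F hε hδ' (Nat.zero_le k)
    have hδk := hδ _ hk
    gcongr
  have hexp := mul_le_mul_of_nonneg_right (Real.exp_le_exp.2 (neg_le_neg hbound))
    (sq_nonneg ‖X (k + 1) - X (k + 2)‖)
  rw [Real.exp_neg (2 * F (ε 1) (δ 1) (X 1) / δbar ^ 2)] at hexp
  rw [mul_comm 2, mul_assoc, ← inv_mul_le_iff₀ (Real.exp_pos _)]
  linarith

theorem tendsto_norm_sub (h : IsIRLSSequence A y r s X ε δ U V) (hεbar : 0 < εbar)
    (hδbar : 0 < δbar) (hεlim : Tendsto ε atTop (𝓝 εbar)) (hδlim : Tendsto δ atTop (𝓝 δbar)) :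
    Tendsto (fun k => ‖X k - X (k + 1)‖) atTop (𝓝 0) := by
  have hε : ∀ k, 1 ≤ k → 0 < ε k := fun k hk => hεbar.trans_le (h.le_eps hεlim hk)
  have hδ : ∀ k, 1 ≤ k → 0 < δ k := fun k hk => hδbar.trans_le (h.le_delta hδlim hk)
  have hbdd : BddBelow (Set.range fun k => F (ε (k + 1)) (δ (k + 1)) (X (k + 1))) :=
    ⟨0, Set.forall_mem_range.2 fun k =>
      F_nonneg (hε _ (Nat.le_add_left 1 k)).le (hδ _ (Nat.le_add_left 1 k)).le _⟩
  have hconv := tendsto_atTop_ciInf (h.antitone_F hε hδ) hbdd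
  have hdecrease := (hconv.sub ((tendsto_add_atTop_iff_nat 1).2 hconv)).const_mul
    (2 * Real.exp (2 * F (ε 1) (δ 1) (X 1) / δbar ^ 2))
  rw [sub_self, mul_zero] at hdecrease
  have hsq := squeeze_zero (fun k => sq_nonneg ‖X (k + 1) - X (k + 2)‖)
    (fun k => h.norm_sub_sq_le hε hδbar (fun k hk => h.le_delta hδlim hk) k) hdecrease
  rw [← tendsto_add_atTop_iff_nat 1]
  simpa using hsq.sqrt

theorem F_add_le_of_tendsto (h : IsIRLSSequence A y r s X ε δ U V) (hεbar : 0 < εbar)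
    (hδbar : 0 < δbar) (hεlim : Tendsto ε atTop (𝓝 εbar)) (hδlim : Tendsto δ atTop (𝓝 δbar))
    {l : Filter ℕ} [l.NeBot] (hl : l ≤ atTop) {Xbar Ξ : Matrix (Fin n₁) (Fin n₂) ℝ}
    (hX : Tendsto X l (𝓝 Xbar)) (hΞ : A Ξ = 0) :
    F εbar δbar (Xbar + Ξ) ≤ F εbar δbar Xbar + ‖Ξ‖ ^ 2 := by
  have hεl := hεlim.mono_left hl
  have hδl := hδlim.mono_left hl
  have hstep := (h.tendsto_norm_sub hεbar hδbar hεlim hδlim).mono_left hl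
  have hright := ((tendsto_F hεbar hδbar hεl hδl hX).add
    ((hstep.const_mul 2).mul_const ‖Ξ‖)).add_const (‖Ξ‖ ^ 2)
  rw [mul_zero, zero_mul, add_zero] at hright
  refine le_of_tendsto_of_tendsto
    (tendsto_F hεbar hδbar hεl hδl (hX.add_const Ξ)) hright ?_
  filter_upwards [hl (eventually_ge_atTop 1)] with k hk
  exact h.F_add_le hk (hεbar.trans_le (h.le_eps hεlim hk)) (hδbar.trans_le (h.le_delta hδlim hk)) hΞ

theorem map_eq_of_tendsto (h : IsIRLSSequence A y r s X ε δ U V) (hεbar : 0 < εbar)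
    (hδbar : 0 < δbar) (hεlim : Tendsto ε atTop (𝓝 εbar)) (hδlim : Tendsto δ atTop (𝓝 δbar))
    {l : Filter ℕ} [l.NeBot] (hl : l ≤ atTop) {Xbar : Matrix (Fin n₁) (Fin n₂) ℝ}
    (hX : Tendsto X l (𝓝 Xbar)) : A Xbar = y := by
  have hA : Continuous A := A.continuous_of_finiteDimensional
  refine tendsto_nhds_unique ((hA.tendsto Xbar).comp hX) (tendsto_const_nhds.congr' ?_)
  filter_upwards [hl (eventually_ge_atTop 1)] with k hk
  exact (h.map_eq hk (hεbar.trans_le (h.le_eps hεlim hk))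
    (hδbar.trans_le (h.le_delta hδlim hk))).symm

theorem isStationaryPoint (h : IsIRLSSequence A y r s X ε δ U V) (hεbar : 0 < εbar)
    (hδbar : 0 < δbar) (hεlim : Tendsto ε atTop (𝓝 εbar)) (hδlim : Tendsto δ atTop (𝓝 δbar))
    {Xbar : Matrix (Fin n₁) (Fin n₂) ℝ} (hX : MapClusterPt Xbar atTop X) :
    IsStationaryPoint A y (F εbar δbar) Xbar := by
  obtain ⟨l, hl, hlX⟩ := mapClusterPt_iff_ultrafilter.1 hX
  have hdiff := differentiableAt_F hεbar hδbar Xbar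
  refine ⟨h.map_eq_of_tendsto hεbar hδbar hεlim hδlim hl hlX, hdiff, fun Ξ hΞ => ?_⟩
  rw [frobInner_matGrad]
  refine fderiv_apply_eq_of_forall_le (c := ‖Ξ‖ ^ 2) hdiff fun t => ?_
  have hle := h.F_add_le_of_tendsto hεbar hδbar hεlim hδlim hl hlX (Ξ := t • Ξ)
    (by rw [map_smul, hΞ, smul_zero])
  rw [norm_smul, mul_pow, Real.norm_eq_abs, sq_abs] at hle
  rwa [mul_zero, add_zero]

end Limit

end IsIRLSSequence

end IRLS

theorem theorem2 {n₁ n₂ m : ℕ} (A : Matrix (Fin n₁) (Fin n₂) ℝ →ₗ[ℝ] (Fin m → ℝ))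
    (y : Fin m → ℝ) (r s : ℕ) (X : ℕ → Matrix (Fin n₁) (Fin n₂) ℝ) (ε δ : ℕ → ℝ)
    (U : ℕ → Matrix (Fin n₁) (Fin n₁) ℝ) (V : ℕ → Matrix (Fin n₂) (Fin n₂) ℝ)
    (h : IRLS.IsIRLSSequence A y r s X ε δ U V) :
    (∀ k, 1 ≤ k → 0 < ε k → 0 < δ k →
      DifferentiableAt ℝ (IRLS.Flr (ε k)) (X k) ∧ DifferentiableAt ℝ (IRLS.Fsp (δ k)) (X k) ∧
      ∀ Z : Matrix (Fin n₁) (Fin n₂) ℝ,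
        IRLS.F (ε k) (δ k) Z ≤
          IRLS.Qlr (X k) (ε k) (U k) (V k) Z + IRLS.Qsp (X k) (δ k) Z) ∧
    (∀ k, 1 ≤ k → 0 < ε k → 0 < δ k →
      IRLS.F (ε (k + 1)) (δ (k + 1)) (X (k + 1)) ≤ IRLS.F (ε k) (δ k) (X k)) ∧
    (∀ εbar δbar : ℝ, 0 < εbar → 0 < δbar →
      Tendsto ε atTop (𝓝 εbar) → Tendsto δ atTop (𝓝 δbar) →
      Tendsto (fun k => ‖X k - X (k + 1)‖) atTop (𝓝 0) ∧
      ∀ Xbar : Matrix (Fin n₁) (Fin n₂) ℝ, MapClusterPt Xbar atTop X →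
        IRLS.IsStationaryPoint A y (IRLS.F εbar δbar) Xbar) :=
  ⟨fun k hk hε hδ => ⟨IRLS.differentiableAt_Flr hε _, IRLS.differentiableAt_Fsp hδ _,
      (h.bases k hk hε hδ).F_le_Q hε hδ⟩,
    fun _ hk hε hδ => h.F_succ_le hk hε hδ,
    fun _ _ hεbar hδbar hεlim hδlim => ⟨h.tendsto_norm_sub hεbar hδbar hεlim hδlim,
      fun _ hX => h.isStationaryPoint hεbar hδbar hεlim hδlim hX⟩⟩
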